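/- A copy of $C_4$ in a graph $G$ is a (not necessarily induced) subgraph of $G$ isomorphic to the cycle $C_4$ of length $4$. All graphs are finite and simple, and a graph is planar if it can be drawn in the Euclidean plane without crossings. For every integer $n\ge 4$, the maximum number of copies of $C_4$ in a triangle-free planar graph on $n$ vertices is $\binom{n-2}{2}$. Moreover, up to isomorphism, the complete bipartite graph $K_{2,n-2}$ is the unique extremal graph: a graph on $n$ vertices is planar, triangle-free and contains exactly $\binom{n-2}{2}$ copies of $C_4$ if and only if it is isomorphic to $K_{2,n-2}$. -/

import Mathlib

namespace PlanarTuran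

/-- A drawing of `G` in the Euclidean plane without crossings: the vertices are distinct points,
every edge is a simple arc joining its two ends, and the relative interior of an edge contains
no vertex and no interior point of another edge. -/
structure PlaneDrawing {V : Type*} (G : SimpleGraph V) where
  /-- the point that represents a vertex -/
  point : V → EuclideanSpace ℝ (Fin 2)
  /-- the arc that represents an edge -/
  arc : G.edgeSet → C(unitInterval, EuclideanSpace ℝ (Fin 2))
  point_injective : Function.Injective point
  arc_injective : ∀ e, Function.Injective (arc e)
  arc_ends : ∀ e : G.edgeSet, s(arc e 0, arc e 1) = Sym2.map point e
  arc_ne_point : ∀ e, ∀ t ∈ Set.Ioo (0 : unitInterval) 1, ∀ v, arc e t ≠ point v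
  arc_ne_arc : ∀ e e', e ≠ e' → ∀ t ∈ Set.Ioo (0 : unitInterval) 1,
    ∀ t' ∈ Set.Ioo (0 : unitInterval) 1, arc e t ≠ arc e' t'

/-- A graph is planar if it can be drawn in the plane without crossings. -/
def IsPlanar {V : Type*} (G : SimpleGraph V) : Prop :=
  Nonempty (PlaneDrawing G)

/-- The numbers of copies of `H` (subgraphs isomorphic to `H`, not necessarily induced) in the
`F`-free planar graphs on `n` vertices. The maximum of this set is the generalized planar Turán
number of `n`, `H` and `F`. -/
def planarCopyCounts {W W' : Type*} (n : ℕ) (H : SimpleGraph W) (F : SimpleGraph W') : Set ℕ :=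
  {m | ∃ G : SimpleGraph (Fin n), IsPlanar G ∧ F.Free G ∧ G.copyCount H = m}

end PlanarTuran

/-!
A copy of `C₄` in a triangle-free graph is an induced subgraph, so that copies correspond to the
vertex sets of four-cycles (`copyCount_cycleGraph_four`). The bound `(n - 2).choose 2` follows by
induction if some vertex `v` is in at most `n - 3` four-cycles. Four-cycles through `v` are counted
by the vertex `u` opposite to `v` and two common neighbours of `u` and `v`. This gives the bound at
once if `v` has degree at most two, with equality only for `K_{2,n-2}`
(`card_filter_fourCycles_le_of_degree_le_two`). Otherwise Euler's formula provides a vertex of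
degree three. As `K₃,₃` is not planar, at most one other vertex shares all three neighbours with it,
which again suffices (`card_filter_fourCycles_le_of_degree_eq_three`), and in the case of equality
the induction hypothesis produces a `K₃,₃`.

The facts on planar graphs all come from the inequality `E + 4 ≤ 2 * V` for triangle-free plane
graphs that are not forests (`card_edges_add_four_le`). Since the edges are arbitrary arcs, the
necessary part of Euler's formula is proved in the style of Borsuk and Eilenberg, by means of
continuous logarithms of nonvanishing functions on closed subsets of the complex plane:

* if a bounded component of the complement of `X` contains `a`, then `z - a` has no logarithm on
  `X`, even up to a factor that is nonvanishing on the closure of the component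
  (`zpow_eq_zero_of_logOn`), whereas `(z - a) / (z - b)` has one if `X` does not separate `a` from
  `b` (`logOn_div_of_mem`);
* conversely, if the complement of `X` is connected, then nonvanishing functions that are one near
  infinity have logarithms on `X` (`logOn_of_isPreconnected_compl`). For this the zeros of an
  extension to the plane are moved along chains of discs into a single disc off `X`.

The second fact shows that an edge that joins two connected vertices splits a face (`exists_split`).
The first one shows that forests do not separate the plane
(`isPreconnected_compl_carrier_of_isAcyclic`), so that the boundary of each face contains a cycle,
and that an edge borders at most two faces (`false_of_three_faces`). With at least `E - V + 2` faces
and at least four edges around each, double counting gives the inequality.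
-/

namespace PlanarTuran

open Set Metric Filter Topology

/-! ### Continuous logarithms on closed subsets of the plane -/

/-- `f` has a continuous logarithm on `S`. For closed `S` the logarithm can be extended to the whole
plane by Tietze's theorem, and this extension is what the definition asks for. -/
def LogOn (f : ℂ → ℂ) (S : Set ℂ) : Prop :=
  ∃ L : C(ℂ, ℂ), ∀ z ∈ S, Complex.exp (L z) = f z

theorem exists_extension_of_continuousOn {X : Type*} [TopologicalSpace X] [NormalSpace X]
    {S : Set X} (hS : IsClosed S) {g : X → ℂ} (hg : ContinuousOn g S) :
    ∃ L : C(X, ℂ), ∀ z ∈ S, L z = g z := by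
  obtain ⟨L, hL⟩ := ContinuousMap.exists_restrict_eq hS ⟨S.domRestrict g, hg.domRestrict⟩
  exact ⟨L, fun z hz => congrArg (fun h : C(S, ℂ) => h ⟨z, hz⟩) hL⟩

theorem LogOn.of_continuousOn {f g : ℂ → ℂ} {S : Set ℂ} (hS : IsClosed S) (hg : ContinuousOn g S)
    (h : ∀ z ∈ S, Complex.exp (g z) = f z) : LogOn f S := by
  obtain ⟨L, hL⟩ := exists_extension_of_continuousOn hS hg
  exact ⟨L, fun z hz => by rw [hL z hz, h z hz]⟩

theorem LogOn.mono {f : ℂ → ℂ} {S T : Set ℂ} (h : LogOn f T) (hST : S ⊆ T) : LogOn f S :=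
  h.imp fun _ hL z hz => hL z (hST hz)

theorem LogOn.congr {f g : ℂ → ℂ} {S : Set ℂ} (h : LogOn f S) (hfg : ∀ z ∈ S, f z = g z) :
    LogOn g S :=
  h.imp fun _ hL z hz => (hL z hz).trans (hfg z hz)

theorem LogOn.mul {f g : ℂ → ℂ} {S : Set ℂ} (hf : LogOn f S) (hg : LogOn g S) :
    LogOn (fun z => f z * g z) S := by
  obtain ⟨L, hL⟩ := hf
  obtain ⟨M, hM⟩ := hg
  exact ⟨L + M, fun z hz => by simp [Complex.exp_add, hL z hz, hM z hz]⟩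

theorem LogOn.inv {f : ℂ → ℂ} {S : Set ℂ} (hf : LogOn f S) : LogOn (fun z => (f z)⁻¹) S := by
  obtain ⟨L, hL⟩ := hf
  exact ⟨-L, fun z hz => by simp [Complex.exp_neg, hL z hz]⟩

/-- Continuous nonvanishing functions on simply connected spaces have logarithms. -/
theorem exists_log_of_simplyConnected {X : Type*} [TopologicalSpace X] [SimplyConnectedSpace X]
    [LocallyPathConnectedSpace X] (f : C(X, ℂ)) (hf : ∀ x, f x ≠ 0) :
    ∃ L : C(X, ℂ), ∀ x, Complex.exp (L x) = f x := by
  obtain ⟨x₀⟩ : Nonempty X := inferInstance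
  obtain ⟨L, ⟨-, hL⟩, -⟩ := Complex.isCoveringMapOn_exp.existsUnique_continuousMap_lifts f
    (a₀ := x₀) (Complex.exp_log (hf x₀)) (fun a => hf a)
  exact ⟨L, fun x => congrFun hL x⟩

theorem logOn_univ (f : C(ℂ, ℂ)) (hf : ∀ x, f x ≠ 0) : LogOn f univ := by
  obtain ⟨L, hL⟩ := exists_log_of_simplyConnected f hf
  exact ⟨L, fun z _ => hL z⟩

/-- Two continuous logarithms of the same function differ by a constant on a connected set. -/
theorem sub_eq_sub_of_exp_eq {X : Type*} [TopologicalSpace X] {S : Set X} (hS : IsPreconnected S)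
    {f g : X → ℂ} (hf : ContinuousOn f S) (hg : ContinuousOn g S)
    (h : ∀ x ∈ S, Complex.exp (f x) = Complex.exp (g x)) {x y : X} (hx : x ∈ S) (hy : y ∈ S) :
    f x - g x = f y - g y := by
  refine hS.constant_of_mapsTo (T := range fun n : ℤ => (n : ℂ) * (2 * Real.pi * Complex.I)) ?_
    (hf.sub hg) ?_ hx hy
  · refine isDiscrete_iff_discreteTopology.2 (DiscreteTopology.of_forall_le_dist one_pos ?_)
    rintro ⟨_, m, rfl⟩ ⟨_, n, rfl⟩ hmn
    have hne : m ≠ n := fun h => hmn (by simp [h])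
    rw [Subtype.dist_eq, dist_eq_norm]
    simp only [← sub_mul, norm_mul, Complex.norm_I, Complex.norm_real, mul_one]
    have h1 : (1 : ℝ) ≤ ‖((m : ℂ) - n)‖ := by
      rw [← Int.cast_sub, Complex.norm_intCast, ← Int.cast_abs]
      exact_mod_cast Int.one_le_abs (sub_ne_zero.2 hne)
    have h2 : (1 : ℝ) ≤ ‖(2 : ℂ)‖ * ‖Real.pi‖ := by
      rw [Real.norm_of_nonneg Real.pi_pos.le, Complex.norm_ofNat]
      nlinarith [Real.pi_gt_three]
    nlinarith
  · intro z hz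
    obtain ⟨n, hn⟩ := Complex.exp_eq_exp_iff_exists_int.1 (h z hz)
    exact ⟨n, by simp [hn]⟩

/-- A nonvanishing function on the plane cannot have a nonzero winding number at infinity. -/
theorem zpow_eq_zero_of_eq_near_infinity (H : C(ℂ, ℂ)) (hH : ∀ z, H z ≠ 0) (a : ℂ) (m : ℤ) (R : ℝ)
    (h : ∀ z, R ≤ ‖z - a‖ → H z = (z - a) ^ m) : m = 0 := by
  obtain ⟨L, hL⟩ := logOn_univ H hH
  set r : ℝ := max R 1
  have hr : 0 < r := lt_max_of_lt_right one_pos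
  have key := sub_eq_sub_of_exp_eq (X := ℝ) (S := univ) isPreconnected_univ
    (f := fun t => L (a + Complex.exp (Real.log r + t * Complex.I)))
    (g := fun t => m * (Real.log r + t * Complex.I)) (by fun_prop) (by fun_prop)
    (fun t _ => by
      rw [hL _ trivial, h, add_sub_cancel_left, Complex.exp_int_mul]
      rw [add_sub_cancel_left, Complex.norm_exp]
      simp [Real.exp_log hr, r]) (mem_univ 0) (mem_univ (2 * Real.pi))
  have e : Complex.exp (Real.log r + ((2 * Real.pi : ℝ) : ℂ) * Complex.I)
      = Complex.exp (Real.log r + ((0 : ℝ) : ℂ) * Complex.I) := by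
    push_cast
    rw [Complex.exp_add, Complex.exp_two_pi_mul_I]
    simp
  simp only [e] at key
  have h3 : (m : ℂ) * (2 * Real.pi * Complex.I) = 0 := by
    push_cast at key
    linear_combination key
  simpa [Real.pi_ne_zero] using h3

/-- The winding number of `z - a` around the boundary of a bounded open set that contains `a` is
not zero: no nonzero power of `z - a` extends from the boundary to a nonvanishing function on the
set. -/
theorem zpow_eq_zero_of_eqOn_frontier {U : Set ℂ} (hU : IsOpen U) (hb : Bornology.IsBounded U)
    {a : ℂ} (ha : a ∈ U) {m : ℤ} {h : ℂ → ℂ} (hc : ContinuousOn h (closure U))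
    (h0 : ∀ z ∈ closure U, h z ≠ 0) (hm : ∀ z ∈ frontier U, h z = (z - a) ^ m) : m = 0 := by
  classical
  obtain ⟨R, hR⟩ := hb.subset_ball a
  have hne : ∀ z ∈ Uᶜ, z - a ≠ 0 := fun z hz h => hz (by rwa [sub_eq_zero.1 h])
  have hcont : Continuous (U.piecewise h fun z => (z - a) ^ m) := by
    rw [← continuousOn_univ, ← union_compl_self (closure U)]
    have hfr : frontier U = closure U \ U := hU.frontier_eq
    refine continuous_piecewise (fun z hz => hm z hz) hc ?_ |>.continuousOn
    rw [hU.isClosed_compl.closure_eq]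
    exact ContinuousOn.zpow₀ (by fun_prop) m fun z hz => Or.inl (hne z hz)
  refine zpow_eq_zero_of_eq_near_infinity ⟨_, hcont⟩ ?_ a m R ?_
  · intro z
    by_cases hz : z ∈ U
    · simpa [hz] using h0 z (subset_closure hz)
    · simpa [hz] using zpow_ne_zero m (hne z hz)
  · intro z hz
    have : z ∉ U := fun hzU => by
      have := hR hzU
      rw [mem_ball, dist_eq_norm] at this
      linarith
    simp [this]

/-- The function `(z - a) / (z - b)` has a logarithm on a closed set that does not separate `a`
from `b`. -/
theorem logOn_div_of_mem {Y K : Set ℂ} (hY : IsClosed Y) (hK : IsPreconnected K) (hKY : K ⊆ Yᶜ)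
    {a b : ℂ} (ha : a ∈ K) (hb : b ∈ K) : LogOn (fun z => (z - a) / (z - b)) Y := by
  have hne : ∀ x ∈ K, ∀ z ∈ Y, z - x ≠ 0 := fun x hx z hz h =>
    hKY hx (by rwa [← sub_eq_zero.1 h])
  refine hK.induction₂ (fun a b => LogOn (fun z => (z - a) / (z - b)) Y) ?_ ?_ ?_ ha hb
  · intro x hx
    obtain ⟨ε, hε, hball⟩ := Metric.isOpen_iff.1 hY.isOpen_compl x (hKY hx)
    filter_upwards [mem_nhdsWithin_of_mem_nhds (Metric.ball_mem_nhds x hε), self_mem_nhdsWithin]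
      with y hy hyK
    have hslit : ∀ z ∈ Y, (z - y) / (z - x) ∈ Complex.slitPlane := by
      intro z hz
      have h1 : ε ≤ ‖z - x‖ := by
        by_contra hlt
        exact hball (mem_ball_iff_norm.2 (not_le.1 hlt)) hz
      have h2 : ‖(x - y) / (z - x)‖ < 1 := by
        rw [norm_div, div_lt_one (hε.trans_le h1)]
        rw [mem_ball_iff_norm'] at hy
        exact hy.trans_le h1
      convert Complex.mem_slitPlane_of_norm_lt_one h2 using 1
      have := hne x hx z hz
      field_simp
      ring
    have : LogOn (fun z => (z - y) / (z - x)) Y := by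
      refine LogOn.of_continuousOn hY (g := fun z => Complex.log ((z - y) / (z - x))) ?_ ?_
      · refine ContinuousOn.clog ?_ hslit
        exact ContinuousOn.div (by fun_prop) (by fun_prop) (fun z hz => hne x hx z hz)
      · intro z hz
        exact Complex.exp_log (Complex.slitPlane_ne_zero (hslit z hz))
    exact this.inv.congr fun z _ => by simp
  · intro x y z _ hy _ h1 h2
    exact (h1.mul h2).congr fun w hw => by
      have := hne y hy w hw
      field_simp
  · intro x y _ _ h
    exact h.inv.congr fun z _ => by simp

/-! ### Moving the zeros of a function of the plane -/

/-- Nonvanishing functions on compact sets of reals have logarithms: the set is cut into short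
pieces, on each of which the function is nearly constant. -/
theorem exists_log_of_isCompact_real {T : Set ℝ} (hT : IsCompact T) {f : ℝ → ℂ}
    (hf : ContinuousOn f T) (h0 : ∀ x ∈ T, f x ≠ 0) :
    ∃ g : ℝ → ℂ, ContinuousOn g T ∧ ∀ x ∈ T, Complex.exp (g x) = f x := by
  rcases T.eq_empty_or_nonempty with rfl | hne
  · exact ⟨0, by simp, by simp⟩
  obtain ⟨y, hyT, hy⟩ := hT.exists_isMinOn hne hf.norm
  obtain ⟨δ, hδ, hδf⟩ := Metric.uniformContinuousOn_iff.1
    (hT.uniformContinuousOn_of_continuous hf) ‖f y‖ (norm_pos_iff.2 (h0 y hyT))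
  obtain ⟨R, hR⟩ := hT.isBounded.subset_ball (0 : ℝ)
  have key : ∀ n : ℕ, ∃ g : ℝ → ℂ, ContinuousOn g (T ∩ Iic (-R + n * (δ / 2))) ∧
      ∀ x ∈ T ∩ Iic (-R + n * (δ / 2)), Complex.exp (g x) = f x := by
    intro n
    induction n with
    | zero =>
      have : T ∩ Iic (-R + (0 : ℕ) * (δ / 2)) = ∅ := by
        refine eq_empty_of_forall_notMem fun x ⟨hx, hx'⟩ => ?_
        have := abs_lt.1 (by simpa using hR hx)
        simp only [Nat.cast_zero, zero_mul, add_zero, mem_Iic] at hx'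
        linarith
      exact ⟨0, by rw [this]; simp, by rw [this]; simp⟩
    | succ n ih =>
      obtain ⟨g, hg, hgf⟩ := ih
      set s := -R + n * (δ / 2) with hs
      have hs' : -R + (n + 1 : ℕ) * (δ / 2) = s + δ / 2 := by push_cast; ring
      have hun : T ∩ Iic (s + δ / 2) = T ∩ Iic s ∪ T ∩ Icc s (s + δ / 2) := by
        rw [← inter_union_distrib_left, Iic_union_Icc_eq_Iic (by linarith)]
      rw [hs', hun]
      rcases (T ∩ Icc s (s + δ / 2)).eq_empty_or_nonempty with he | ⟨x₀, hx₀T, hx₀⟩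
      · rw [he, union_empty]
        exact ⟨g, hg, hgf⟩
      have hslit : ∀ x ∈ T ∩ Icc s (s + δ / 2), f x / f x₀ ∈ Complex.slitPlane := by
        rintro x ⟨hxT, hx⟩
        have h1 := hδf x hxT x₀ hx₀T (by
          rw [Real.dist_eq]
          have : |x - x₀| ≤ δ / 2 :=
            abs_le.2 ⟨by linarith [hx.1, hx₀.2], by linarith [hx.2, hx₀.1]⟩
          linarith)
        have h2 : ‖(f x - f x₀) / f x₀‖ < 1 := by
          rw [norm_div, div_lt_one (norm_pos_iff.2 (h0 x₀ hx₀T)), ← dist_eq_norm]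
          exact h1.trans_le (hy hx₀T)
        convert Complex.mem_slitPlane_of_norm_lt_one h2 using 1
        have := h0 x₀ hx₀T
        field_simp
        ring
      set l : ℝ → ℂ := fun x => Complex.log (f x / f x₀) + Complex.log (f x₀)
      have hl : ContinuousOn l (T ∩ Icc s (s + δ / 2)) :=
        (ContinuousOn.clog ((hf.mono inter_subset_left).div_const _) hslit).add continuousOn_const
      have hlf : ∀ x ∈ T ∩ Icc s (s + δ / 2), Complex.exp (l x) = f x := by
        intro x hx
        have h3 := h0 x₀ hx₀T
        rw [Complex.exp_add, Complex.exp_log (Complex.slitPlane_ne_zero (hslit x hx)),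
          Complex.exp_log h3]
        field_simp
      -- the constant that makes the two logarithms agree at the cut, if the cut lies in `T`
      obtain ⟨c, hc, hcs⟩ : ∃ c : ℂ, Complex.exp c = 1 ∧ (s ∈ T → l s + c = g s) := by
        by_cases hsT : s ∈ T
        · refine ⟨g s - l s, ?_, fun _ => by ring⟩
          rw [Complex.exp_sub, hgf s ⟨hsT, self_mem_Iic⟩, hlf s ⟨hsT, le_rfl, by linarith⟩,
            div_self (h0 s hsT)]
        · exact ⟨0, Complex.exp_zero, fun h => absurd h hsT⟩
      have e1 : EqOn (fun x => if x ≤ s then g x else l x + c) g (T ∩ Iic s) :=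
        fun x hx => if_pos hx.2
      have e2 : EqOn (fun x => if x ≤ s then g x else l x + c) (fun x => l x + c)
          (T ∩ Icc s (s + δ / 2)) := by
        intro x hx
        rcases eq_or_lt_of_le hx.2.1 with rfl | h
        · simp [hcs hx.1]
        · exact if_neg (not_le.2 h)
      refine ⟨fun x => if x ≤ s then g x else l x + c, ?_, ?_⟩
      · exact (hg.congr e1).union_of_isClosed ((hl.add continuousOn_const).congr e2)
          (hT.isClosed.inter isClosed_Iic) (hT.isClosed.inter isClosed_Icc)
      · rintro x (hx | hx)
        · rw [e1 hx, hgf x hx]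
        · rw [e2 hx, Complex.exp_add, hc, hlf x hx, mul_one]
  obtain ⟨n, hn⟩ := exists_nat_gt (2 * R / (δ / 2))
  obtain ⟨g, hg⟩ := key n
  have : T ∩ Iic (-R + n * (δ / 2)) = T := by
    refine inter_eq_left.2 fun x hx => ?_
    have := abs_lt.1 (by simpa using hR hx)
    rw [div_lt_iff₀ (by linarith)] at hn
    rw [mem_Iic]
    linarith
  exact ⟨g, by rwa [this] at hg⟩

/-- A closed proper subset of a circle lies in an arc, so nonvanishing functions on it have
logarithms. -/
theorem logOn_of_subset_sphere {c x₀ : ℂ} {r : ℝ} (hr : 0 < r) (hx₀ : x₀ ∈ sphere c r) {T : Set ℂ}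
    (hT : IsClosed T) (hTs : T ⊆ sphere c r) (hxT : x₀ ∉ T) {f : ℂ → ℂ} (hf : ContinuousOn f T)
    (h0 : ∀ z ∈ T, f z ≠ 0) : LogOn f T := by
  have hx0n : ‖x₀ - c‖ = r := mem_sphere_iff_norm.1 hx₀
  have hx0 : x₀ - c ≠ 0 := norm_pos_iff.1 (hx0n ▸ hr)
  have hn : ∀ z ∈ T, ‖-((z - c) / (x₀ - c))‖ = 1 := by
    intro z hz
    rw [norm_neg, norm_div, hx0n, mem_sphere_iff_norm.1 (hTs hz), div_self hr.ne']
  have hslit : ∀ z ∈ T, -((z - c) / (x₀ - c)) ∈ Complex.slitPlane := by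
    intro z hz
    rw [Complex.mem_slitPlane_iff]
    by_contra! h
    -- a point of the unit circle outside the slit plane is `-1`, which corresponds to `x₀`
    have h1 := Complex.abs_re_eq_norm.2 h.2
    rw [hn z hz, abs_of_nonpos h.1] at h1
    have h2 : -((z - c) / (x₀ - c)) = -1 := Complex.ext
      (by rw [Complex.neg_re 1, Complex.one_re]; linarith) (by rw [h.2]; simp)
    rw [neg_inj, div_eq_one_iff_eq hx0, sub_left_inj] at h2
    exact hxT (h2 ▸ hz)
  have hφ : ContinuousOn (fun z => Complex.arg (-((z - c) / (x₀ - c)))) T := fun z hz =>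
    ((Complex.continuousAt_arg (hslit z hz)).comp (f := fun z => -((z - c) / (x₀ - c)))
      (by fun_prop)).continuousWithinAt
  have hψ : ∀ z ∈ T, c - (x₀ - c) * Complex.exp
      (Complex.arg (-((z - c) / (x₀ - c))) * Complex.I) = z := by
    intro z hz
    have := Complex.norm_mul_exp_arg_mul_I (-((z - c) / (x₀ - c)))
    rw [hn z hz, Complex.ofReal_one, one_mul] at this
    rw [this]
    field_simp
    ring
  have hTc : IsCompact T := (isCompact_sphere c r).of_isClosed_subset hT hTs
  obtain ⟨g, hg, hgf⟩ := exists_log_of_isCompact_real (hTc.image_of_continuousOn hφ)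
    (f := fun t => f (c - (x₀ - c) * Complex.exp (t * Complex.I)))
    (hf.comp (by fun_prop) (by rintro _ ⟨z, hz, rfl⟩; dsimp only; rwa [hψ z hz]))
    (by rintro _ ⟨z, hz, rfl⟩; dsimp only; rw [hψ z hz]; exact h0 z hz)
  refine LogOn.of_continuousOn hT (hg.comp hφ (mapsTo_image _ _)) fun z hz => ?_
  rw [Function.comp_apply, hgf _ (mem_image_of_mem _ hz), hψ z hz]

/-- The zeros that functions have in `B` can be moved to `B'` by a change on a bounded part of `W`,
whatever other zeros there are. -/
def ZerosMove (W B B' : Set ℂ) : Prop :=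
  ∀ O : Set ℂ, IsOpen O → ∀ f : C(ℂ, ℂ), (∀ z ∉ O ∪ B, f z ≠ 0) →
    ∃ f' : C(ℂ, ℂ), (∀ z ∉ O ∪ B', f' z ≠ 0) ∧ (∀ z ∉ W, f' z = f z) ∧
      ∃ R : ℝ, ∀ z, R < ‖z‖ → f' z = f z

theorem ZerosMove.trans {W B B' B'' : Set ℂ} (h : ZerosMove W B B') (h' : ZerosMove W B' B'') :
    ZerosMove W B B'' := by
  intro O hO f hf
  obtain ⟨f₁, h1, h2, R, h3⟩ := h O hO f hf
  obtain ⟨f₂, h4, h5, R', h6⟩ := h' O hO f₁ h1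
  exact ⟨f₂, h4, fun z hz => (h5 z hz).trans (h2 z hz), max R R', fun z hz =>
    (h6 z ((le_max_right _ _).trans_lt hz)).trans (h3 z ((le_max_left _ _).trans_lt hz))⟩

/-- Zeros in a disc can be moved to any open set `B'` that meets the boundary circle: what remains
of the circle is contained in an arc, so the function has a logarithm there, and this logarithm
extends to the disc. -/
theorem zerosMove_of_mem_sphere {W B' : Set ℂ} (hW : IsOpen W) (hB' : IsOpen B') {c x₀ : ℂ} {r : ℝ}
    (hr : 0 < r) (hcW : closedBall c r ⊆ W) (hx₀ : x₀ ∈ sphere c r) (hx₀B : x₀ ∈ B') :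
    ZerosMove W (ball c r) B' := by
  classical
  intro O hO f hf
  have hOB : IsOpen (O ∪ B') := hO.union hB'
  obtain ⟨L, hL⟩ : LogOn f (sphere c r \ (O ∪ B')) := by
    refine logOn_of_subset_sphere hr hx₀ (isClosed_sphere.sdiff hOB) sdiff_subset
      (fun h => h.2 (Or.inr hx₀B)) f.continuous.continuousOn fun z hz => hf z ?_
    rintro (h | h)
    · exact hz.2 (Or.inl h)
    · exact (mem_ball.1 h).ne (mem_sphere.1 hz.1)
  set N := W ∩ ball c (r + 1) with hN
  have hNo : IsOpen N := hW.inter isOpen_ball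
  have hDN : closedBall c r ⊆ N := subset_inter hcW (closedBall_subset_ball (by linarith))
  set E₁ := closedBall c r \ (O ∪ B') with hE₁
  set E₂ := (ball c r)ᶜ \ ((O ∪ B') ∩ N) with hE₂
  have hE₁c : IsClosed E₁ := isClosed_closedBall.sdiff hOB
  have hE₂c : IsClosed E₂ := isOpen_ball.isClosed_compl.sdiff (hOB.inter hNo)
  have e1 : EqOn (fun z => if z ∈ closedBall c r then Complex.exp (L z) else f z)
      (fun z => Complex.exp (L z)) E₁ := fun z hz => if_pos hz.1
  have e2 : EqOn (fun z => if z ∈ closedBall c r then Complex.exp (L z) else f z) f E₂ := by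
    intro z hz
    by_cases h : z ∈ closedBall c r
    · refine (if_pos h).trans ?_
      refine hL z ⟨?_, fun h' => hz.2 ⟨h', hDN h⟩⟩
      exact le_antisymm (mem_closedBall.1 h) (not_lt.1 hz.1)
    · exact if_neg h
  obtain ⟨f', hf'⟩ := exists_extension_of_continuousOn (hE₁c.union hE₂c)
    (ContinuousOn.union_of_isClosed
      ((Continuous.continuousOn (by fun_prop)).congr e1)
      (f.continuous.continuousOn.congr e2) hE₁c hE₂c)
  have hf1 : ∀ z ∈ E₁, f' z = Complex.exp (L z) := fun z hz => (hf' z (Or.inl hz)).trans (e1 hz)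
  have hf2 : ∀ z ∈ E₂, f' z = f z := fun z hz => (hf' z (Or.inr hz)).trans (e2 hz)
  have hNf : ∀ z ∉ N, f' z = f z := fun z hz =>
    hf2 z ⟨fun h => hz (hDN (ball_subset_closedBall h)), fun h => hz h.2⟩
  refine ⟨f', fun z hz => ?_, fun z hz => hNf z fun h => hz h.1, ‖c‖ + (r + 1), fun z hz =>
    hNf z fun h => ?_⟩
  · by_cases h : z ∈ closedBall c r
    · rw [hf1 z ⟨h, hz⟩]
      exact Complex.exp_ne_zero _
    · have hb : z ∉ ball c r := fun h' => h (ball_subset_closedBall h')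
      rw [hf2 z ⟨hb, fun h' => hz h'.1⟩]
      exact hf z fun h' => h'.elim (fun h' => hz (Or.inl h')) hb
  · have := mem_ball_iff_norm.1 h.2
    have := norm_sub_norm_le z c
    linarith

/-- In a connected open set, small discs around any two points can be connected by a chain of discs
along which zeros are moved. -/
theorem exists_zerosMove {W : Set ℂ} (hW : IsOpen W) (hc : IsPreconnected W) {x y : ℂ}
    (hx : x ∈ W) (hy : y ∈ W) : ∃ ε > 0, ∀ r ρ : ℝ, 0 < r → r < ε → 0 < ρ → ρ < ε →
      ZerosMove W (ball x r) (ball y ρ) := by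
  -- a small disc is enlarged until its boundary passes through the target
  have step : ∀ x y : ℂ, x ≠ y → closedBall x (dist x y) ⊆ W → ∃ ε > 0, ∀ r ρ : ℝ, 0 < r → r < ε →
      0 < ρ → ρ < ε → ZerosMove W (ball x r) (ball y ρ) := by
    intro x y hxy hb
    refine ⟨dist x y, dist_pos.2 hxy, fun r ρ hr hr' hρ _ => ?_⟩
    obtain ⟨p, hp⟩ := NormedSpace.sphere_nonempty (x := x).2 hr.le
    refine (zerosMove_of_mem_sphere hW (B' := ball x (dist x y)) isOpen_ball hr
      ((closedBall_subset_closedBall hr'.le).trans hb) hp ?_).trans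
      (zerosMove_of_mem_sphere hW isOpen_ball (dist_pos.2 hxy) hb (x₀ := y) ?_ (mem_ball_self hρ))
    · exact mem_ball.2 ((mem_sphere.1 hp).trans_lt hr')
    · exact mem_sphere'.2 rfl
  have trans : ∀ x y z : ℂ, (∃ ε > 0, ∀ r ρ : ℝ, 0 < r → r < ε → 0 < ρ → ρ < ε →
      ZerosMove W (ball x r) (ball y ρ)) → (∃ ε > 0, ∀ r ρ : ℝ, 0 < r → r < ε → 0 < ρ → ρ < ε →
      ZerosMove W (ball y r) (ball z ρ)) → ∃ ε > 0, ∀ r ρ : ℝ, 0 < r → r < ε → 0 < ρ → ρ < ε →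
      ZerosMove W (ball x r) (ball z ρ) := by
    rintro x y z ⟨ε, hε, h⟩ ⟨ε', hε', h'⟩
    refine ⟨min ε ε', lt_min hε hε', fun r ρ hr hr' hρ hρ' => ?_⟩
    have hm : 0 < min ε ε' / 2 := half_pos (lt_min hε hε')
    have hm' : min ε ε' / 2 < min ε ε' := half_lt_self (lt_min hε hε')
    exact (h r _ hr (hr'.trans_le (min_le_left _ _)) hm (hm'.trans_le (min_le_left _ _))).trans
      (h' _ ρ hm (hm'.trans_le (min_le_right _ _)) hρ (hρ'.trans_le (min_le_right _ _)))
  have near : ∀ x ∈ W, ∃ ε > 0, ∀ y ∈ ball x ε, y ≠ x →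
      closedBall x (dist x y) ⊆ W ∧ closedBall y (dist y x) ⊆ W := by
    intro x hx
    obtain ⟨ε, hε, hb⟩ := Metric.isOpen_iff.1 hW x hx
    refine ⟨ε / 2, half_pos hε, fun y hy _ => ⟨fun z hz => hb ?_, fun z hz => hb ?_⟩⟩
    · rw [mem_closedBall, dist_comm x y] at hz
      rw [mem_ball] at hy ⊢
      linarith
    · rw [mem_closedBall] at hz
      rw [mem_ball] at hy ⊢
      linarith [dist_triangle z y x]
  refine hc.induction₂' (fun x y => ∃ ε > 0, ∀ r ρ : ℝ, 0 < r → r < ε → 0 < ρ → ρ < ε →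
      ZerosMove W (ball x r) (ball y ρ)) ?_ (fun x y z _ _ _ => trans x y z) hx hy
  intro x hx
  obtain ⟨ε, hε, hn⟩ := near x hx
  filter_upwards [mem_nhdsWithin_of_mem_nhds (Metric.ball_mem_nhds x hε)] with y hy
  by_cases hyx : y = x
  · subst hyx
    obtain ⟨p, hp⟩ := NormedSpace.sphere_nonempty (x := y).2 (half_pos hε).le
    rw [mem_sphere] at hp
    have hpy : p ≠ y := dist_pos.1 (hp ▸ half_pos hε)
    obtain ⟨h1, h2⟩ := hn p (by rw [mem_ball]; linarith) hpy
    have := trans y p y (step y p hpy.symm h1) (step p y hpy h2)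
    exact ⟨this, this⟩
  · obtain ⟨h1, h2⟩ := hn y hy hyx
    exact ⟨step x y (Ne.symm hyx) h1, step y x hyx h2⟩

/-- If `f` is nonvanishing outside a disc and equal to one near infinity, then it has a logarithm
outside the disc. An inversion turns the outside of the disc into a disc. -/
theorem logOn_compl_ball {f : C(ℂ, ℂ)} {a : ℂ} {r R : ℝ} (hr : 0 < r)
    (h0 : ∀ z ∉ ball a r, f z ≠ 0) (h1 : ∀ z, R < ‖z‖ → f z = 1) : LogOn f (ball a r)ᶜ := by
  set g : ℂ → ℂ := fun w => if w = 0 then 1 else f (a + w⁻¹ * (max 1 (r * ‖w‖) : ℝ)) with hg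
  have hlarge : ∀ w : ℂ, w ≠ 0 → r ≤ ‖w⁻¹ * (max 1 (r * ‖w‖) : ℝ)‖ ∧
      ‖w‖⁻¹ ≤ ‖w⁻¹ * (max 1 (r * ‖w‖) : ℝ)‖ := by
    intro w hw
    have hw' : 0 < ‖w‖ := norm_pos_iff.2 hw
    rw [norm_mul, norm_inv, Complex.norm_real, Real.norm_of_nonneg (le_max_of_le_left zero_le_one)]
    constructor
    · rw [inv_mul_eq_div, le_div_iff₀ hw']
      exact le_max_right _ _
    · exact le_mul_of_one_le_right (inv_nonneg.2 hw'.le) (le_max_left _ _)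
  have hg0 : ∀ w, g w ≠ 0 := by
    intro w
    by_cases hw : w = 0
    · simp [hg, hw]
    · simp only [hg, if_neg hw]
      refine h0 _ fun hb => ?_
      rw [mem_ball_iff_norm, add_sub_cancel_left] at hb
      exact absurd (hlarge w hw).1 (not_le.2 hb)
  have hgc : Continuous g := by
    rw [continuous_iff_continuousAt]
    intro w
    by_cases hw : w = 0
    · subst hw
      have hpos : 0 < |R| + ‖a‖ + 1 := by positivity
      have : g =ᶠ[𝓝 0] fun _ => 1 := by
        filter_upwards [Metric.ball_mem_nhds (0 : ℂ) (inv_pos.2 hpos)] with w hw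
        by_cases hw0 : w = 0
        · simp [hg, hw0]
        · simp only [hg, if_neg hw0]
          refine h1 _ ?_
          have h2 : |R| + ‖a‖ + 1 < ‖w‖⁻¹ := by
            rw [lt_inv_comm₀ hpos (norm_pos_iff.2 hw0)]
            simpa using hw
          have h3 := (hlarge w hw0).2
          have h4 := norm_sub_le_norm_add (w⁻¹ * ((max 1 (r * ‖w‖) : ℝ) : ℂ)) a
          rw [add_comm a]
          linarith [le_abs_self R]
      exact continuousAt_const.congr this.symm
    · have h2 : ContinuousAt (fun w : ℂ => f (a + w⁻¹ * (max 1 (r * ‖w‖) : ℝ))) w := by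
        refine f.continuous.continuousAt.comp (f := fun w : ℂ => a + w⁻¹ * (max 1 (r * ‖w‖) : ℝ)) ?_
        refine continuousAt_const.add ((continuousAt_inv₀ hw).mul ?_)
        exact (by fun_prop : Continuous fun w : ℂ => ((max 1 (r * ‖w‖) : ℝ) : ℂ)).continuousAt
      refine h2.congr ?_
      filter_upwards [isOpen_ne.mem_nhds hw] with z hz
      simp only [hg, if_neg hz]
  obtain ⟨M, hM⟩ := logOn_univ ⟨g, hgc⟩ hg0
  have hne : ∀ z ∈ (ball a r)ᶜ, z - a ≠ 0 := fun z hz h => hz (by simp [sub_eq_zero.1 h, hr])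
  refine LogOn.of_continuousOn isOpen_ball.isClosed_compl (g := fun z => M ((z - a)⁻¹)) ?_ ?_
  · exact M.continuous.comp_continuousOn (ContinuousOn.inv₀ (by fun_prop) hne)
  · intro z hz
    have h2 := hne z hz
    have h3 : r ≤ ‖z - a‖ := by simpa [dist_eq_norm] using hz
    have h4 : max 1 (r * ‖(z - a)⁻¹‖) = 1 := by
      refine max_eq_left ?_
      rw [norm_inv]
      exact mul_inv_le_one_of_le₀ h3 (norm_nonneg _)
    rw [hM _ trivial]
    simp only [ContinuousMap.coe_mk, hg, inv_eq_zero, if_neg h2, h4, inv_inv]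
    simp

/-- On a closed set that does not separate the plane, nonvanishing functions that are equal to one
near infinity have logarithms. -/
theorem logOn_of_isPreconnected_compl {Y : Set ℂ} (hY : IsClosed Y) (hc : IsPreconnected Yᶜ)
    (f : C(ℂ, ℂ)) (h0 : ∀ z ∈ Y, f z ≠ 0) {R : ℝ} (h1 : ∀ z, R < ‖z‖ → f z = 1) : LogOn f Y := by
  rcases (Yᶜ).eq_empty_or_nonempty with he | ⟨a, ha⟩
  · rw [compl_empty_iff] at he
    subst he
    exact logOn_univ f fun z => h0 z trivial
  have hW : IsOpen Yᶜ := hY.isOpen_compl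
  set Z := {z | f z = 0} with hZdef
  have hZ : IsCompact Z := by
    refine Metric.isCompact_of_isClosed_isBounded (isClosed_eq f.continuous continuous_const) ?_
    refine isBounded_closedBall (x := (0 : ℂ)) (r := R) |>.subset fun z hz => ?_
    rw [mem_closedBall_zero_iff]
    by_contra h
    exact one_ne_zero ((h1 z (not_le.1 h)).symm.trans hz)
  have hZW : Z ⊆ Yᶜ := fun z hz hzY => h0 z hzY hz
  choose! ε hε hmove using fun x (hx : x ∈ Yᶜ) => exists_zerosMove hW hc hx ha
  obtain ⟨t, htZ, htc⟩ := hZ.elim_nhds_subcover (fun x => ball x (ε x / 2)) fun x hx =>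
    ball_mem_nhds x (half_pos (hε x (hZW hx)))
  obtain ⟨s, hs, hsb⟩ := Metric.isOpen_iff.1 hW a ha
  -- a radius that suits all discs of the cover
  obtain ⟨ρ, hρ, hρs, hρt⟩ : ∃ ρ > 0, ρ ≤ s ∧ ∀ x ∈ t, ρ < ε x := by
    have : ∀ᶠ ρ in 𝓝[>] (0 : ℝ), ρ ≤ s ∧ ∀ x ∈ t, ρ < ε x := by
      refine ((eventually_le_nhds hs).filter_mono nhdsWithin_le_nhds).and ?_
      rw [Finset.eventually_all]
      exact fun x hx => (eventually_lt_nhds (hε x (hZW (htZ x hx)))).filter_mono nhdsWithin_le_nhds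
    obtain ⟨ρ, h, hρ⟩ := (this.and self_mem_nhdsWithin).exists
    exact ⟨ρ, hρ, h⟩
  have key : ∀ u : Finset ℂ, u ⊆ t → ∀ f : C(ℂ, ℂ),
      (∀ z ∉ (⋃ x ∈ u, ball x (ε x / 2)) ∪ ball a ρ, f z ≠ 0) →
      ∃ f' : C(ℂ, ℂ), (∀ z ∉ ball a ρ, f' z ≠ 0) ∧ (∀ z ∈ Y, f' z = f z) ∧
        ∃ R : ℝ, ∀ z, R < ‖z‖ → f' z = f z := by
    intro u
    induction u using Finset.induction_on with
    | empty => exact fun _ f hf => ⟨f, fun z hz => hf z (by simpa using hz), fun _ _ => rfl,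
        0, fun _ _ => rfl⟩
    | insert x u hxu ih =>
      intro hu f hf
      have hxt : x ∈ t := hu (Finset.mem_insert_self x u)
      have hεx := hε x (hZW (htZ x hxt))
      obtain ⟨f₁, h2, h3, R₁, h4⟩ := hmove x (hZW (htZ x hxt)) (ε x / 2) ρ (half_pos hεx)
        (half_lt_self hεx) hρ (hρt x hxt) ((⋃ x ∈ u, ball x (ε x / 2)) ∪ ball a ρ)
        ((isOpen_biUnion fun _ _ => isOpen_ball).union isOpen_ball) f fun z hz => hf z fun h => by
          rw [Finset.set_biUnion_insert] at h
          rcases h with (h | h) | h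
          exacts [hz (Or.inr h), hz (Or.inl (Or.inl h)), hz (Or.inl (Or.inr h))]
      rw [union_assoc, union_self] at h2
      obtain ⟨f₂, h5, h6, R₂, h7⟩ := ih (fun y hy => hu (Finset.mem_insert_of_mem hy)) f₁ h2
      exact ⟨f₂, h5, fun z hz => (h6 z hz).trans (h3 z fun h => h hz), max R₁ R₂, fun z hz =>
        (h7 z ((le_max_right _ _).trans_lt hz)).trans (h4 z ((le_max_left _ _).trans_lt hz))⟩
  obtain ⟨f', h2, h3, R', h4⟩ := key t subset_rfl f fun z hz hzf => hz (Or.inl (htc hzf))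
  refine ((logOn_compl_ball (R := max R R') hρ h2 fun z hz => ?_).mono fun z hz hzb => ?_).congr h3
  · rw [h4 z ((le_max_right _ _).trans_lt hz), h1 z ((le_max_left _ _).trans_lt hz)]
  · exact hsb (ball_subset_ball hρs hzb) hz

/-! ### Components of the complement of a compact set -/

theorem isPreconnected_compl_closedBall {R : ℝ} (hR : 0 < R) :
    IsPreconnected (closedBall (0 : ℂ) R)ᶜ := by
  have h : Complex.exp '' {w : ℂ | Real.log R < w.re} = (closedBall (0 : ℂ) R)ᶜ := by
    ext z
    rw [mem_compl_iff, mem_closedBall_zero_iff, not_le]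
    constructor
    · rintro ⟨w, hw, rfl⟩
      rw [Complex.norm_exp]
      exact (Real.log_lt_iff_lt_exp hR).1 hw
    · intro hz
      have hz0 : z ≠ 0 := norm_pos_iff.1 (hR.trans hz)
      refine ⟨Complex.log z, ?_, Complex.exp_log hz0⟩
      rw [mem_ofPred_eq, Complex.log_re]
      exact Real.log_lt_log hR hz
  rw [← h]
  exact (convex_halfSpace_re_gt _).isPreconnected.image _ Complex.continuous_exp.continuousOn

theorem isOpen_connectedComponentIn_compl {X : Set ℂ} (hX : IsClosed X) (a : ℂ) :
    IsOpen (connectedComponentIn Xᶜ a) :=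
  hX.isOpen_compl.connectedComponentIn

/-- The frontier of a component of the complement of `X` lies in `X`. -/
theorem closure_connectedComponentIn_compl_subset {X : Set ℂ} (hX : IsClosed X) (a : ℂ) :
    closure (connectedComponentIn Xᶜ a) ⊆ connectedComponentIn Xᶜ a ∪ X := by
  intro x hx
  by_cases hxX : x ∈ X
  · exact Or.inr hxX
  obtain ⟨y, hy, hya⟩ := mem_closure_iff.1 hx _ (isOpen_connectedComponentIn_compl hX x)
    (mem_connectedComponentIn hxX)
  rw [connectedComponentIn_eq hya, ← connectedComponentIn_eq hy]
  exact Or.inl (mem_connectedComponentIn hxX)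

theorem frontier_connectedComponentIn_compl_subset {X : Set ℂ} (hX : IsClosed X) (a : ℂ) :
    frontier (connectedComponentIn Xᶜ a) ⊆ X := by
  rw [(isOpen_connectedComponentIn_compl hX a).frontier_eq]
  exact fun x hx => (closure_connectedComponentIn_compl_subset hX a hx.1).resolve_left hx.2

/-- At most one component of the complement of a compact set is unbounded. -/
theorem isBounded_or_isBounded_of_ne {X : Set ℂ} (hX : IsCompact X) {a b : ℂ}
    (h : connectedComponentIn Xᶜ a ≠ connectedComponentIn Xᶜ b) :
    Bornology.IsBounded (connectedComponentIn Xᶜ a) ∨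
      Bornology.IsBounded (connectedComponentIn Xᶜ b) := by
  obtain ⟨R, hR, hXR⟩ := hX.isBounded.subset_closedBall_lt 0 (0 : ℂ)
  have hsub : (closedBall (0 : ℂ) R)ᶜ ⊆ Xᶜ := compl_subset_compl.2 hXR
  have key : ∀ c, ¬ Bornology.IsBounded (connectedComponentIn Xᶜ c) →
      (closedBall (0 : ℂ) R)ᶜ ⊆ connectedComponentIn Xᶜ c := by
    intro c hc
    obtain ⟨x, hx, hxR⟩ := not_subset.1 fun h => hc (isBounded_closedBall.subset h)
    rw [connectedComponentIn_eq hx]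
    exact (isPreconnected_compl_closedBall hR).subset_connectedComponentIn hxR hsub
  by_contra! hab
  have hz : (2 * R : ℂ) ∈ (closedBall (0 : ℂ) R)ᶜ := by
    rw [mem_compl_iff, mem_closedBall_zero_iff, not_le, norm_mul, Complex.norm_real,
      Real.norm_of_nonneg hR.le, Complex.norm_ofNat]
    linarith
  exact h ((connectedComponentIn_eq (key a hab.1 hz)).trans
    (connectedComponentIn_eq (key b hab.2 hz)).symm)

/-- If `(z - a) ^ m * r z` has a logarithm on `X`, where `r` is nonvanishing on the closure of the
bounded component of `a`, then `m = 0`. -/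
theorem zpow_eq_zero_of_logOn {X : Set ℂ} (hX : IsClosed X) {a : ℂ} (ha : a ∉ X)
    (hb : Bornology.IsBounded (connectedComponentIn Xᶜ a)) {m : ℤ} {r : ℂ → ℂ}
    (hr : ContinuousOn r (closure (connectedComponentIn Xᶜ a)))
    (hr0 : ∀ z ∈ closure (connectedComponentIn Xᶜ a), r z ≠ 0)
    (h : LogOn (fun z => (z - a) ^ m * r z) X) : m = 0 := by
  obtain ⟨L, hL⟩ := h
  refine zpow_eq_zero_of_eqOn_frontier (isOpen_connectedComponentIn_compl hX a) hb
    (mem_connectedComponentIn ha) (h := fun z => Complex.exp (L z) / r z) ?_ ?_ ?_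
  · exact ContinuousOn.div (by fun_prop) hr hr0
  · exact fun z hz => div_ne_zero (Complex.exp_ne_zero _) (hr0 z hz)
  · intro z hz
    have := hr0 z (frontier_subset_closure hz)
    rw [hL z (frontier_connectedComponentIn_compl_subset hX a hz)]
    field_simp

/-- A compact set on which all nonvanishing functions have logarithms does not separate the
plane. -/
theorem isPreconnected_compl_of_forall_logOn {X : Set ℂ} (hX : IsCompact X)
    (h : ∀ f : ℂ → ℂ, ContinuousOn f X → (∀ z ∈ X, f z ≠ 0) → LogOn f X) :
    IsPreconnected Xᶜ := by
  have hXc := hX.isClosed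
  have key : ∀ a ∉ X, ∀ b ∉ X, Bornology.IsBounded (connectedComponentIn Xᶜ a) →
      connectedComponentIn Xᶜ a = connectedComponentIn Xᶜ b := by
    intro a ha b hb hbd
    by_contra hne
    have hbU : ∀ z ∈ closure (connectedComponentIn Xᶜ a), z - b ≠ 0 := by
      intro z hz hzb
      rw [sub_eq_zero.1 hzb] at hz
      exact hne (connectedComponentIn_eq
        ((closure_connectedComponentIn_compl_subset hXc a hz).resolve_right hb))
    have hXne : ∀ c ∉ X, ∀ z ∈ X, z - c ≠ 0 := fun c hc z hz h0 => hc (sub_eq_zero.1 h0 ▸ hz)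
    have := zpow_eq_zero_of_logOn hXc ha hbd (m := 1) (r := fun z => (z - b)⁻¹)
      (ContinuousOn.inv₀ (by fun_prop) hbU) (fun z hz => inv_ne_zero (hbU z hz))
      (h _ (ContinuousOn.mul (by simpa using by fun_prop)
        (ContinuousOn.inv₀ (by fun_prop) (hXne b hb)))
        fun z hz => mul_ne_zero (by simpa using hXne a ha z hz) (inv_ne_zero (hXne b hb z hz)))
    exact one_ne_zero this
  refine isPreconnected_of_forall_pair fun a ha b hb => ⟨connectedComponentIn Xᶜ a,
    connectedComponentIn_subset _ _, mem_connectedComponentIn ha, ?_,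
    isPreconnected_connectedComponentIn⟩
  have : connectedComponentIn Xᶜ a = connectedComponentIn Xᶜ b := by
    by_contra hne
    rcases isBounded_or_isBounded_of_ne hX hne with h1 | h1
    · exact hne (key a ha b hb h1)
    · exact hne (key b hb a ha h1).symm
  rw [this]
  exact mem_connectedComponentIn hb

/-! ### Logarithms on unions and arcs -/

theorem logOn_union {f : ℂ → ℂ} {S T : Set ℂ} (hS : IsClosed S) (hT : IsClosed T) {L M : C(ℂ, ℂ)}
    (hL : ∀ z ∈ S, Complex.exp (L z) = f z) (hM : ∀ z ∈ T, Complex.exp (M z) = f z)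
    (h : ∀ z ∈ S ∩ T, L z = M z) : LogOn f (S ∪ T) := by
  classical
  have e1 : EqOn (fun z => if z ∈ S then L z else M z) L S := fun z hz => if_pos hz
  have e2 : EqOn (fun z => if z ∈ S then L z else M z) M T := by
    intro z hz
    by_cases hzS : z ∈ S
    · exact (if_pos hzS).trans (h z ⟨hzS, hz⟩)
    · exact if_neg hzS
  refine LogOn.of_continuousOn (hS.union hT) ((L.continuous.continuousOn.congr e1).union_of_isClosed
    (M.continuous.continuousOn.congr e2) hS hT) ?_
  rintro z (hz | hz)
  · exact (congrArg _ (e1 hz)).trans (hL z hz)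
  · exact (congrArg _ (e2 hz)).trans (hM z hz)

theorem LogOn.union_of_subsingleton {f : ℂ → ℂ} {S T : Set ℂ} (hS : IsClosed S) (hT : IsClosed T)
    (hfS : LogOn f S) (hfT : LogOn f T) {p : ℂ} (h : S ∩ T ⊆ {p}) : LogOn f (S ∪ T) := by
  obtain ⟨L, hL⟩ := hfS
  obtain ⟨M, hM⟩ := hfT
  by_cases hp : p ∈ S ∩ T
  · refine logOn_union hS hT hL (M := M + ContinuousMap.const ℂ (L p - M p)) (fun z hz => ?_)
      fun z hz => ?_
    · simp only [ContinuousMap.add_apply, ContinuousMap.const_apply, Complex.exp_add,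
        Complex.exp_sub, hL p hp.1, hM p hp.2, hM z hz]
      rw [← hL p hp.1, div_self (Complex.exp_ne_zero _), mul_one]
    · rw [mem_singleton_iff.1 (h hz)]
      simp
  · refine logOn_union hS hT hL hM fun z hz => absurd ?_ hp
    rwa [← mem_singleton_iff.1 (h hz)]

theorem exists_extension_of_arc {γ : C(unitInterval, ℂ)} (hγ : Function.Injective γ)
    (L : C(unitInterval, ℂ)) : ∃ M : C(ℂ, ℂ), ∀ t, M (γ t) = L t := by
  obtain ⟨M, hM⟩ := L.exists_extension (γ.continuous.isClosedEmbedding hγ)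
  exact ⟨M, fun t => congrArg (fun h : C(unitInterval, ℂ) => h t) hM⟩

theorem logOn_range {γ : C(unitInterval, ℂ)} (hγ : Function.Injective γ) {f : ℂ → ℂ}
    (hf : ContinuousOn f (range γ)) (h0 : ∀ z ∈ range γ, f z ≠ 0) : LogOn f (range γ) := by
  obtain ⟨L', hL'⟩ := exists_log_of_simplyConnected (X := ℝ)
    ⟨fun t => f (γ (projIcc 0 1 zero_le_one t)), hf.comp_continuous
      (γ.continuous.comp continuous_projIcc) fun t => mem_range_self _⟩
    fun t => h0 _ (mem_range_self _)
  set L : C(unitInterval, ℂ) := ⟨fun t => L' t, by fun_prop⟩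
  have hL : ∀ t, Complex.exp (L t) = f (γ t) := fun t => by simpa [L] using hL' t
  obtain ⟨M, hM⟩ := exists_extension_of_arc hγ L
  refine ⟨M, ?_⟩
  rintro _ ⟨t, rfl⟩
  rw [hM]
  exact hL t

/-! ### Plane graphs in the complex plane -/

/-- The Euclidean plane as the complex plane. -/
noncomputable def planeEquiv : EuclideanSpace ℝ (Fin 2) ≃ₜ ℂ :=
  Complex.orthonormalBasisOneI.repr.symm.toHomeomorph

namespace PlaneDrawing

variable {V : Type*} {G : SimpleGraph V} (D : PlaneDrawing G)

/-- The complex number that represents a vertex. -/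
noncomputable def pt (v : V) : ℂ := planeEquiv (D.point v)

/-- The arc of the complex plane that represents an edge. -/
noncomputable def path (e : G.edgeSet) : C(unitInterval, ℂ) :=
  ⟨fun t => planeEquiv (D.arc e t), by fun_prop⟩

/-- The arc of an edge without its two ends. -/
def inner (e : G.edgeSet) : Set ℂ := D.path e '' Ioo 0 1

/-- The part of the drawing that consists of the vertices in `S` and the edges in `F`. -/
def carrier (S : Set V) (F : Set (Sym2 V)) : Set ℂ :=
  D.pt '' S ∪ ⋃ e : {e : G.edgeSet // (e : Sym2 V) ∈ F}, range (D.path e)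

theorem pt_injective : Function.Injective D.pt :=
  planeEquiv.injective.comp D.point_injective

theorem path_injective (e : G.edgeSet) : Function.Injective (D.path e) :=
  planeEquiv.injective.comp (D.arc_injective e)

/-- The ends of the arc of an edge, named in the order in which the arc runs. -/
theorem exists_ends (e : G.edgeSet) :
    ∃ u v : V, (e : Sym2 V) = s(u, v) ∧ D.path e 0 = D.pt u ∧ D.path e 1 = D.pt v := by
  have h := D.arc_ends e
  obtain ⟨e, he⟩ := e
  induction e using Sym2.ind with
  | _ u v =>
    rw [Sym2.map_mk, Sym2.eq_iff] at h
    rcases h with ⟨h0, h1⟩ | ⟨h0, h1⟩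
    · exact ⟨u, v, rfl, congrArg planeEquiv h0, congrArg planeEquiv h1⟩
    · exact ⟨v, u, Sym2.eq_swap, congrArg planeEquiv h0, congrArg planeEquiv h1⟩

theorem pt_notMem_inner (e : G.edgeSet) (v : V) : D.pt v ∉ D.inner e := by
  rintro ⟨t, ht, h⟩
  exact D.arc_ne_point e t ht v (planeEquiv.injective h)

theorem eq_of_mem_inner {e e' : G.edgeSet} {z : ℂ} (h : z ∈ D.inner e) (h' : z ∈ D.inner e') :
    e = e' := by
  obtain ⟨t, ht, rfl⟩ := h
  obtain ⟨t', ht', h⟩ := h'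
  by_contra hne
  exact D.arc_ne_arc e e' hne t ht t' ht' (planeEquiv.injective h.symm)

theorem inner_subset_range (e : G.edgeSet) : D.inner e ⊆ range (D.path e) :=
  image_subset_range _ _

theorem range_path_subset {e : G.edgeSet} {u v : V} (h0 : D.path e 0 = D.pt u)
    (h1 : D.path e 1 = D.pt v) : range (D.path e) ⊆ D.inner e ∪ D.pt '' {u, v} := by
  rintro _ ⟨t, rfl⟩
  rcases eq_or_lt_of_le t.2.1 with h | h
  · have : t = 0 := Subtype.ext h.symm
    rw [this, h0]
    exact Or.inr ⟨u, by simp, rfl⟩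
  rcases eq_or_lt_of_le t.2.2 with h' | h'
  · have : t = 1 := Subtype.ext h'
    rw [this, h1]
    exact Or.inr ⟨v, by simp, rfl⟩
  · exact Or.inl ⟨t, ⟨h, h'⟩, rfl⟩

theorem isPreconnected_inner (e : G.edgeSet) : IsPreconnected (D.inner e) :=
  isPreconnected_Ioo.image _ (D.path e).continuous.continuousOn

theorem range_subset_carrier {S : Set V} {F : Set (Sym2 V)} {e : G.edgeSet}
    (he : (e : Sym2 V) ∈ F) : range (D.path e) ⊆ D.carrier S F :=
  fun _ hz => Or.inr (mem_iUnion.2 ⟨⟨e, he⟩, hz⟩)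

theorem pt_mem_carrier {S : Set V} (F : Set (Sym2 V)) {v : V} (hv : v ∈ S) :
    D.pt v ∈ D.carrier S F :=
  Or.inl (mem_image_of_mem _ hv)

/-- A set of edges whose ends belong to `S` adds to the vertices in `S` only the inner points of the
edges. -/
theorem mem_carrier_iff {S : Set V} {F : Set (Sym2 V)} (h : ∀ e ∈ F, ∀ v ∈ e, v ∈ S) {z : ℂ} :
    z ∈ D.carrier S F ↔ z ∈ D.pt '' S ∨ ∃ e : G.edgeSet, (e : Sym2 V) ∈ F ∧ z ∈ D.inner e := by
  constructor
  · rintro (hz | hz)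
    · exact Or.inl hz
    · obtain ⟨⟨e, he⟩, hz⟩ := mem_iUnion.1 hz
      obtain ⟨u, v, huv, h0, h1⟩ := D.exists_ends e
      rcases D.range_path_subset h0 h1 hz with hz | ⟨w, hw, rfl⟩
      · exact Or.inr ⟨e, he, hz⟩
      · refine Or.inl ⟨w, h _ he w ?_, rfl⟩
        rw [huv]
        simpa using hw
  · rintro (hz | ⟨e, he, hz⟩)
    · exact Or.inl hz
    · exact D.range_subset_carrier he (D.inner_subset_range e hz)

theorem carrier_inter_subset {S S' : Set V} {F F' : Set (Sym2 V)} (h : ∀ e ∈ F, ∀ v ∈ e, v ∈ S)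
    (h' : ∀ e ∈ F', ∀ v ∈ e, v ∈ S') (hFF : Disjoint F F') :
    D.carrier S F ∩ D.carrier S' F' ⊆ D.pt '' (S ∩ S') := by
  rintro z ⟨hz, hz'⟩
  rw [D.mem_carrier_iff h] at hz
  rw [D.mem_carrier_iff h'] at hz'
  rcases hz with ⟨v, hv, rfl⟩ | ⟨e, he, hz⟩
  · rcases hz' with ⟨w, hw, hwv⟩ | ⟨e, -, hz⟩
    · rw [D.pt_injective hwv] at hw
      exact ⟨v, ⟨hv, hw⟩, rfl⟩
    · exact absurd hz (D.pt_notMem_inner e v)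
  · rcases hz' with ⟨w, -, rfl⟩ | ⟨e', he', hz'⟩
    · exact absurd hz (D.pt_notMem_inner e w)
    · rw [← D.eq_of_mem_inner hz hz'] at he'
      exact absurd he' (disjoint_left.1 hFF he)

theorem carrier_mono (S : Set V) {F F' : Set (Sym2 V)} (h : F ⊆ F') :
    D.carrier S F ⊆ D.carrier S F' := by
  rintro z (hz | hz)
  · exact Or.inl hz
  · obtain ⟨⟨e, he⟩, hz⟩ := mem_iUnion.1 hz
    exact D.range_subset_carrier (h he) hz

theorem carrier_insert (S : Set V) (F : Set (Sym2 V)) (e : G.edgeSet) :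
    D.carrier S (insert (e : Sym2 V) F) = D.carrier S F ∪ range (D.path e) := by
  refine Subset.antisymm ?_ (union_subset (D.carrier_mono S (subset_insert _ _))
    (D.range_subset_carrier (mem_insert _ _)))
  rintro z (hz | hz)
  · exact Or.inl (Or.inl hz)
  · obtain ⟨⟨e', he'⟩, hz⟩ := mem_iUnion.1 hz
    rcases he' with he' | he'
    · rw [← Subtype.ext he']
      exact Or.inr hz
    · exact Or.inl (D.range_subset_carrier he' hz)

theorem isCompact_carrier [Finite V] (S : Set V) (F : Set (Sym2 V)) :
    IsCompact (D.carrier S F) :=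
  ((toFinite S).image _).isCompact.union
    (isCompact_iUnion fun e => isCompact_range (D.path e).continuous)

theorem isClosed_carrier [Finite V] (S : Set V) (F : Set (Sym2 V)) : IsClosed (D.carrier S F) :=
  (D.isCompact_carrier S F).isClosed

theorem isClosed_range_path (e : G.edgeSet) : IsClosed (range (D.path e)) :=
  (isCompact_range (D.path e).continuous).isClosed

theorem disjoint_inner_carrier {F : Set (Sym2 V)} {e : G.edgeSet} (he : (e : Sym2 V) ∉ F)
    {z : ℂ} (hz : z ∈ D.inner e) : z ∉ D.carrier univ F := by
  rw [D.mem_carrier_iff fun _ _ v _ => mem_univ v]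
  rintro (⟨v, -, rfl⟩ | ⟨e', he', hz'⟩)
  · exact D.pt_notMem_inner e v hz
  · exact he (D.eq_of_mem_inner hz hz' ▸ he')

/-- Nonvanishing functions on a plane forest have logarithms: the forest is built up by edges that
join two different components. -/
theorem logOn_carrier_of_isAcyclic [Finite V] {H : SimpleGraph V} (hHG : H ≤ G)
    (hH : H.IsAcyclic) {f : ℂ → ℂ} (hf : ContinuousOn f (D.carrier univ H.edgeSet))
    (h0 : ∀ z ∈ D.carrier univ H.edgeSet, f z ≠ 0) : LogOn f (D.carrier univ H.edgeSet) := by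
  induction hn : H.edgeSet.ncard generalizing H with
  | zero =>
    rw [ncard_eq_zero] at hn
    rw [hn] at h0 ⊢
    have hfin : (D.carrier univ ∅).Finite := by
      have : IsEmpty {e : G.edgeSet // (e : Sym2 V) ∈ (∅ : Set (Sym2 V))} := ⟨fun e => e.2⟩
      rw [carrier, iUnion_of_empty, union_empty]
      exact (toFinite _).image _
    exact LogOn.of_continuousOn hfin.isClosed (g := fun z => Complex.log (f z))
      (hfin.continuousOn _) fun z hz => Complex.exp_log (h0 z hz)
  | succ n ih =>
    obtain ⟨e, he⟩ : H.edgeSet.Nonempty := nonempty_of_ncard_ne_zero (by omega)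
    set E : G.edgeSet := ⟨e, SimpleGraph.edgeSet_mono hHG he⟩
    obtain ⟨u, v, huv, hu, hv⟩ := D.exists_ends E
    have huv : e = s(u, v) := huv
    set H' := H.deleteEdges {e} with hH'def
    have hH'e : H'.edgeSet = H.edgeSet \ {e} := SimpleGraph.edgeSet_deleteEdges _
    have hH'H : H' ≤ H := SimpleGraph.deleteEdges_le _
    have hnr : ¬ H'.Reachable u v := by
      have := SimpleGraph.isAcyclic_iff_forall_isBridge.1 hH he
      rw [huv, SimpleGraph.isBridge_iff, ← huv] at this
      exact this
    have hins : H.edgeSet = insert e H'.edgeSet := by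
      rw [hH'e, insert_sdiff_singleton, insert_eq_of_mem he]
    have hcar : D.carrier univ H.edgeSet = D.carrier univ H'.edgeSet ∪ range (D.path E) := by
      rw [hins]
      exact D.carrier_insert univ _ E
    have hl : LogOn f (D.carrier univ H'.edgeSet) := by
      refine ih (hH'H.trans hHG) (hH.anti hH'H) (hf.mono ?_) (fun z hz => h0 z ?_) ?_
      · exact D.carrier_mono _ (SimpleGraph.edgeSet_mono hH'H)
      · exact D.carrier_mono _ (SimpleGraph.edgeSet_mono hH'H) hz
      · rw [hH'e, ncard_sdiff_singleton_of_mem he]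
        omega
    -- the part of the forest that is joined to `u`, and the rest, which is joined to `v` or to none
    set A : Set V := {w | H'.Reachable u w}
    set FA : Set (Sym2 V) := {e ∈ H'.edgeSet | ∀ w ∈ e, w ∈ A}
    set FB : Set (Sym2 V) := {e ∈ H'.edgeSet | ∀ w ∈ e, w ∈ Aᶜ}
    have hFA : ∀ e ∈ FA, ∀ w ∈ e, w ∈ A := fun e h => h.2
    have hFB : ∀ e ∈ FB, ∀ w ∈ e, w ∈ Aᶜ := fun e h => h.2
    have hsplit : D.carrier univ H'.edgeSet = D.carrier A FA ∪ D.carrier Aᶜ FB := by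
      apply Subset.antisymm
      · rintro z (⟨w, -, rfl⟩ | hz)
        · by_cases hw : w ∈ A
          · exact Or.inl (D.pt_mem_carrier _ hw)
          · exact Or.inr (D.pt_mem_carrier _ hw)
        · obtain ⟨⟨⟨e', heG⟩, he'⟩, hz⟩ := mem_iUnion.1 hz
          induction e' using Sym2.ind with
          | _ a b =>
            have hab : H'.Adj a b := he'
            have hiff : a ∈ A ↔ b ∈ A :=
              ⟨fun h => h.trans hab.reachable, fun h => h.trans hab.symm.reachable⟩
            by_cases ha : a ∈ A
            · exact Or.inl (D.range_subset_carrier (e := ⟨s(a, b), heG⟩)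
                (show s(a, b) ∈ FA from ⟨he', by simp [ha, hiff.1 ha]⟩) hz)
            · exact Or.inr (D.range_subset_carrier (e := ⟨s(a, b), heG⟩)
                (show s(a, b) ∈ FB from ⟨he', by simp [ha, ← hiff]⟩) hz)
      · refine union_subset ?_ ?_ <;>
        · rintro z (⟨w, -, rfl⟩ | hz)
          · exact D.pt_mem_carrier _ trivial
          · obtain ⟨⟨e', he'⟩, hz⟩ := mem_iUnion.1 hz
            exact D.range_subset_carrier he'.1 hz
    have hE : range (D.path E) ⊆ D.carrier {u, v} {e} := D.range_subset_carrier rfl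
    have hEe : ∀ e' ∈ ({e} : Set (Sym2 V)), ∀ w ∈ e', w ∈ ({u, v} : Set V) := by
      rintro _ rfl w hw
      rw [huv] at hw
      simpa using hw
    have heA : Disjoint FA {e} := by
      rw [disjoint_singleton_right]
      exact fun h => (hH'e ▸ h.1 : e ∈ H.edgeSet \ {e}).2 rfl
    have heB : Disjoint FB {e} := by
      rw [disjoint_singleton_right]
      exact fun h => (hH'e ▸ h.1 : e ∈ H.edgeSet \ {e}).2 rfl
    have hAB : Disjoint FA FB := by
      rw [disjoint_left]
      intro e' h h'
      induction e' using Sym2.ind with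
      | _ a b => exact h'.2 a (by simp) (h.2 a (by simp))
    have hlE : LogOn f (range (D.path E)) := by
      refine logOn_range (D.path_injective E) (hf.mono ?_) fun z hz => h0 z ?_
      · exact D.range_subset_carrier he
      · exact D.range_subset_carrier (e := E) he hz
    have h1 : LogOn f (D.carrier A FA ∪ range (D.path E)) := by
      refine LogOn.union_of_subsingleton (p := D.pt u) (D.isClosed_carrier _ _)
        (D.isClosed_range_path _) (hl.mono (hsplit ▸ subset_union_left)) hlE ?_
      rintro z ⟨hz, hz'⟩
      obtain ⟨w, ⟨hwA, hw⟩, rfl⟩ := D.carrier_inter_subset hFA hEe heA ⟨hz, hE hz'⟩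
      rcases hw with rfl | rfl
      · rfl
      · exact absurd hwA hnr
    rw [hcar, hsplit, union_right_comm]
    refine LogOn.union_of_subsingleton (p := D.pt v)
      ((D.isClosed_carrier _ _).union (D.isClosed_range_path _)) (D.isClosed_carrier _ _) h1
      (hl.mono (hsplit ▸ subset_union_right)) ?_
    rintro z ⟨hz | hz, hz'⟩
    · obtain ⟨w, hw, -⟩ := D.carrier_inter_subset hFA hFB hAB ⟨hz, hz'⟩
      exact absurd hw.1 hw.2
    · obtain ⟨w, ⟨hwA, hw⟩, rfl⟩ := D.carrier_inter_subset hFB hEe heB ⟨hz', hE hz⟩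
      rcases hw with rfl | rfl
      · exact absurd (SimpleGraph.Reachable.refl _) hwA
      · rfl

/-- A plane forest does not separate the plane. -/
theorem isPreconnected_compl_carrier_of_isAcyclic [Finite V] {H : SimpleGraph V} (hHG : H ≤ G)
    (hH : H.IsAcyclic) : IsPreconnected (D.carrier univ H.edgeSet)ᶜ :=
  isPreconnected_compl_of_forall_logOn (D.isCompact_carrier _ _) fun _ hf h0 =>
    D.logOn_carrier_of_isAcyclic hHG hH hf h0

/-! ### Faces -/

/-- An edge that joins two already connected vertices splits the face in which it lies. Otherwise
the function that is one outside this face and runs once around the unit circle on the edge would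
have a logarithm. -/
theorem exists_split [Finite V] {T : SimpleGraph V} (hTG : T ≤ G) {F : Set (Sym2 V)}
    (hTF : T.edgeSet ⊆ F) {e : G.edgeSet} (he : (e : Sym2 V) ∉ F) {u v : V}
    (h0 : D.path e 0 = D.pt u) (h1 : D.path e 1 = D.pt v) (huv : T.Reachable u v) :
    ∃ x ∈ (D.carrier univ (insert (e : Sym2 V) F))ᶜ,
      ∃ y ∈ (D.carrier univ (insert (e : Sym2 V) F))ᶜ,
      D.inner e ⊆ connectedComponentIn (D.carrier univ F)ᶜ x ∧
      y ∈ connectedComponentIn (D.carrier univ F)ᶜ x ∧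
      y ∉ connectedComponentIn (D.carrier univ (insert (e : Sym2 V) F))ᶜ x := by
  set X := D.carrier univ F with hX
  have hXc : IsClosed X := D.isClosed_carrier _ _
  rw [D.carrier_insert, ← hX]
  obtain ⟨p₀, hp₀⟩ : (D.inner e).Nonempty := (nonempty_Ioo.2 zero_lt_one).image _
  have hinner : D.inner e ⊆ Xᶜ := fun z hz => D.disjoint_inner_carrier he hz
  set U := connectedComponentIn Xᶜ p₀ with hU
  have hUo : IsOpen U := isOpen_connectedComponentIn_compl hXc _
  have hUX : U ⊆ Xᶜ := connectedComponentIn_subset _ _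
  have heU : D.inner e ⊆ U := (D.isPreconnected_inner e).subset_connectedComponentIn hp₀ hinner
  by_contra! hcon
  have hW : IsPreconnected (Uᶜ ∪ range (D.path e))ᶜ := by
    rw [compl_union, compl_compl]
    refine isPreconnected_of_forall_pair fun x hx y hy =>
      ⟨connectedComponentIn (X ∪ range (D.path e))ᶜ x, ?_, ?_, ?_,
        isPreconnected_connectedComponentIn⟩
    · intro z hz
      have hz' := connectedComponentIn_subset _ _ hz
      refine ⟨?_, fun h => hz' (Or.inr h)⟩
      rw [hU, connectedComponentIn_eq hx.1]
      exact connectedComponentIn_mono x (compl_subset_compl.2 subset_union_left) hz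
    · exact mem_connectedComponentIn fun h => h.elim (hUX hx.1) hx.2
    · have hUx : U = connectedComponentIn Xᶜ x := connectedComponentIn_eq hx.1
      exact hcon x (fun h => h.elim (hUX hx.1) hx.2) y (fun h => h.elim (hUX hy.1) hy.2)
        (hUx ▸ heU) (hUx ▸ hy.1)
  obtain ⟨R, hR, hball⟩ :=
    (isCompact_range (D.path e).continuous).isBounded.subset_ball_lt 0 (0 : ℂ)
  obtain ⟨φ, hφ⟩ := exists_extension_of_arc (D.path_injective e)
    ⟨fun t => 2 * Real.pi * Complex.I * ((t : ℝ) : ℂ), by fun_prop⟩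
  simp only [ContinuousMap.coe_mk] at hφ
  classical
  set A : Set ℂ := Uᶜ ∪ (ball 0 R)ᶜ with hA
  have hAc : IsClosed A := hUo.isClosed_compl.union isOpen_ball.isClosed_compl
  have hEc := D.isClosed_range_path e
  set g : ℂ → ℂ := fun z => if z ∈ range (D.path e) then Complex.exp (φ z) else 1 with hg
  have e1 : EqOn g (fun _ => 1) A := by
    intro z hz
    by_cases hzE : z ∈ range (D.path e)
    · have hzU : z ∉ U := hz.resolve_right fun h => h (hball hzE)
      simp only [hg, if_pos hzE]
      obtain ⟨t, rfl⟩ := hzE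
      rw [hφ]
      rcases eq_or_lt_of_le t.2.1 with h | h
      · rw [← h]
        simp
      rcases eq_or_lt_of_le t.2.2 with h' | h'
      · rw [h']
        simp [Complex.exp_two_pi_mul_I]
      · exact absurd (heU ⟨t, ⟨h, h'⟩, rfl⟩) hzU
    · simp only [hg, if_neg hzE]
  have e2 : EqOn g (fun z => Complex.exp (φ z)) (range (D.path e)) := fun z hz => if_pos hz
  obtain ⟨f, hf⟩ := exists_extension_of_continuousOn (hAc.union hEc)
    ((continuousOn_const.congr e1).union_of_isClosed
      ((Continuous.continuousOn (by fun_prop)).congr e2) hAc hEc)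
  have hf1 : ∀ z ∈ A, f z = 1 := fun z hz => (hf z (Or.inl hz)).trans (e1 hz)
  have hf2 : ∀ t, f (D.path e t) = Complex.exp (2 * Real.pi * Complex.I * ((t : ℝ) : ℂ)) := by
    intro t
    rw [← hφ]
    exact (hf _ (Or.inr (mem_range_self t))).trans (e2 (mem_range_self t))
  obtain ⟨L, hL⟩ := logOn_of_isPreconnected_compl (hUo.isClosed_compl.union hEc) hW f
    (by
      rintro z (hz | ⟨t, rfl⟩)
      · rw [hf1 z (Or.inl hz)]
        exact one_ne_zero
      · rw [hf2]
        exact Complex.exp_ne_zero _) (R := R)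
    (fun z hz => hf1 z (Or.inr fun h => by
      rw [mem_ball_zero_iff] at h
      linarith))
  have hLX : ∀ z ∈ X, Complex.exp (L z) = 1 := fun z hz => by
    have hzU : z ∈ Uᶜ := fun h => hUX h hz
    rw [hL z (Or.inl hzU), hf1 z (Or.inl hzU)]
  -- the logarithm is constant on the connected parts of `X`
  have hconst : ∀ a b, T.Reachable a b → L (D.pt a) = L (D.pt b) := by
    intro a b hab
    obtain ⟨w⟩ := hab
    induction w with
    | nil => rfl
    | @cons a b c hadj w ih =>
      rw [← ih]
      set e' : G.edgeSet := ⟨s(a, b), hTG hadj⟩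
      have he' : (e' : Sym2 V) ∈ F := hTF hadj
      have hstep := fun s t => sub_eq_sub_of_exp_eq (X := unitInterval) isPreconnected_univ
        (f := fun t => L (D.path e' t)) (g := fun _ => 0) (by fun_prop) (by fun_prop)
        (fun t _ => by
          rw [Complex.exp_zero]
          exact hLX _ (D.range_subset_carrier he' (mem_range_self t))) (mem_univ s) (mem_univ t)
      simp only [sub_zero] at hstep
      obtain ⟨a', b', hab, ha', hb'⟩ := D.exists_ends e'
      have hab : s(a, b) = s(a', b') := hab
      have h := hstep 0 1
      rw [ha', hb'] at h
      rcases Sym2.eq_iff.1 hab with ⟨rfl, rfl⟩ | ⟨rfl, rfl⟩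
      · exact h
      · exact h.symm
  have key := sub_eq_sub_of_exp_eq (X := unitInterval) isPreconnected_univ
    (f := fun t => L (D.path e t)) (g := fun t => 2 * Real.pi * Complex.I * ((t : ℝ) : ℂ))
    (by fun_prop) (by fun_prop)
    (fun t _ => by rw [hL _ (Or.inr (mem_range_self t)), hf2]) (mem_univ 0) (mem_univ 1)
  rw [h0, h1, hconst u v huv] at key
  simp only [Icc.coe_zero, Icc.coe_one, Complex.ofReal_zero, Complex.ofReal_one] at key
  exact Complex.two_pi_I_ne_zero (by linear_combination key)

/-- Three distinct faces, two of them bounded, do not border the same edge. Off the edge they are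
part of one face, so the functions `(z - a) / (z - c)` and `(z - b) / (z - c)` have logarithms on the
rest of the drawing. On the edge they have logarithms too, and each pair of logarithms fails to match
by an integer. Some nontrivial product of powers of the two functions has matching logarithms, hence
a logarithm on the whole drawing, although the drawing separates `a`, `b` and `c`. -/
theorem false_of_three_faces_of_isBounded [Finite V] (e : G.edgeSet) {a b c : ℂ}
    (ha : a ∉ D.carrier univ G.edgeSet) (hb : b ∉ D.carrier univ G.edgeSet)
    (hc : c ∉ D.carrier univ G.edgeSet)
    (hab : connectedComponentIn (D.carrier univ G.edgeSet)ᶜ a ≠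
      connectedComponentIn (D.carrier univ G.edgeSet)ᶜ b)
    (hac : connectedComponentIn (D.carrier univ G.edgeSet)ᶜ a ≠
      connectedComponentIn (D.carrier univ G.edgeSet)ᶜ c)
    (hbc : connectedComponentIn (D.carrier univ G.edgeSet)ᶜ b ≠
      connectedComponentIn (D.carrier univ G.edgeSet)ᶜ c)
    (hae : (D.inner e ∩ closure (connectedComponentIn (D.carrier univ G.edgeSet)ᶜ a)).Nonempty)
    (hbe : (D.inner e ∩ closure (connectedComponentIn (D.carrier univ G.edgeSet)ᶜ b)).Nonempty)
    (hce : (D.inner e ∩ closure (connectedComponentIn (D.carrier univ G.edgeSet)ᶜ c)).Nonempty)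
    (hba : Bornology.IsBounded (connectedComponentIn (D.carrier univ G.edgeSet)ᶜ a))
    (hbb : Bornology.IsBounded (connectedComponentIn (D.carrier univ G.edgeSet)ᶜ b)) : False := by
  have hins : G.edgeSet = insert (e : Sym2 V) (G.edgeSet \ {(e : Sym2 V)}) := by
    rw [insert_sdiff_singleton, insert_eq_of_mem e.2]
  have hXins : D.carrier univ G.edgeSet =
      D.carrier univ (G.edgeSet \ {(e : Sym2 V)}) ∪ range (D.path e) := by
    conv_lhs => rw [hins]
    exact D.carrier_insert _ _ _
  set X := D.carrier univ G.edgeSet with hX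
  set X' := D.carrier univ (G.edgeSet \ {(e : Sym2 V)}) with hX'
  have hXc : IsClosed X := D.isClosed_carrier _ _
  have hX'c : IsClosed X' := D.isClosed_carrier _ _
  have hEc := D.isClosed_range_path e
  have hX'X : X' ⊆ X := hXins ▸ subset_union_left
  have hinner : D.inner e ⊆ X'ᶜ := fun z hz => D.disjoint_inner_carrier (fun h => h.2 rfl) hz
  obtain ⟨p₀, hp₀⟩ : (D.inner e).Nonempty := hae.left
  -- without the edge, the three faces form part of one face
  have hK : ∀ x ∉ X, (D.inner e ∩ closure (connectedComponentIn Xᶜ x)).Nonempty →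
      x ∈ connectedComponentIn X'ᶜ p₀ := by
    rintro x hx ⟨z, hz, hzU⟩
    have h1 : insert z (connectedComponentIn Xᶜ x) ⊆ X'ᶜ := insert_subset (hinner hz)
      ((connectedComponentIn_subset _ _).trans (compl_subset_compl.2 hX'X))
    have h2 : IsPreconnected (insert z (connectedComponentIn Xᶜ x)) :=
      isPreconnected_connectedComponentIn.subset_closure (subset_insert _ _)
        (insert_subset hzU subset_closure)
    have h3 := (D.isPreconnected_inner e).subset_connectedComponentIn hp₀ hinner hz
    have h4 := h2.subset_connectedComponentIn (mem_insert _ _) h1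
      (mem_insert_of_mem _ (mem_connectedComponentIn hx))
    rwa [connectedComponentIn_eq h3]
  have hlog : ∀ x ∉ X, (D.inner e ∩ closure (connectedComponentIn Xᶜ x)).Nonempty →
      LogOn (fun z => (z - x) / (z - c)) X' := fun x hx hxe =>
    logOn_div_of_mem hX'c isPreconnected_connectedComponentIn
      (connectedComponentIn_subset X'ᶜ p₀) (hK x hx hxe) (hK c hc hce)
  have hne : ∀ x ∉ X, ∀ z ∈ X, z - x ≠ 0 := fun x hx z hz h => hx (sub_eq_zero.1 h ▸ hz)
  have hEX : range (D.path e) ⊆ X := hXins ▸ subset_union_right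
  have hlogE : ∀ x ∉ X, LogOn (fun z => (z - x) / (z - c)) (range (D.path e)) := by
    intro x hx
    refine logOn_range (D.path_injective e) ?_ fun z hz =>
      div_ne_zero (hne x hx z (hEX hz)) (hne c hc z (hEX hz))
    exact ContinuousOn.div (by fun_prop) (by fun_prop) fun z hz => hne c hc z (hEX hz)
  obtain ⟨u, v, -, hu, hv⟩ := D.exists_ends e
  have hinter : ∀ z ∈ X' ∩ range (D.path e), z = D.pt u ∨ z = D.pt v := by
    rintro z ⟨hz, hzE⟩
    rcases D.range_path_subset hu hv hzE with hzI | ⟨w, hw, rfl⟩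
    · exact absurd hz (hinner hzI)
    · rcases hw with rfl | rfl
      exacts [Or.inl rfl, Or.inr rfl]
  have hmono : ∀ x ∉ X, (D.inner e ∩ closure (connectedComponentIn Xᶜ x)).Nonempty →
      ∃ (L M : C(ℂ, ℂ)) (n : ℤ), (∀ z ∈ X', Complex.exp (L z) = (z - x) / (z - c)) ∧
        (∀ z ∈ range (D.path e), Complex.exp (M z) = (z - x) / (z - c)) ∧
        L (D.pt u) = M (D.pt u) ∧ L (D.pt v) = M (D.pt v) + n * (2 * Real.pi * Complex.I) := by
    intro x hx hxe
    obtain ⟨L, hL⟩ := hlog x hx hxe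
    obtain ⟨M, hM⟩ := hlogE x hx
    have huX : D.pt u ∈ X' := D.pt_mem_carrier _ (mem_univ u)
    have hvX : D.pt v ∈ X' := D.pt_mem_carrier _ (mem_univ v)
    have huE : D.pt u ∈ range (D.path e) := ⟨0, hu⟩
    have hvE : D.pt v ∈ range (D.path e) := ⟨1, hv⟩
    have hM' : ∀ z ∈ range (D.path e),
        Complex.exp ((M + ContinuousMap.const ℂ (L (D.pt u) - M (D.pt u))) z) =
          (z - x) / (z - c) := by
      intro z hz
      simp only [ContinuousMap.add_apply, ContinuousMap.const_apply, Complex.exp_add,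
        Complex.exp_sub, hM z hz]
      rw [hL _ huX, hM _ huE, div_self, mul_one]
      exact div_ne_zero (hne x hx _ (hEX huE)) (hne c hc _ (hEX huE))
    obtain ⟨n, hn⟩ := Complex.exp_eq_exp_iff_exists_int.1 ((hL _ hvX).trans (hM' _ hvE).symm)
    exact ⟨L, _, n, hL, hM', by simp, hn⟩
  obtain ⟨L₁, M₁, n₁, hL₁, hM₁, hu₁, hv₁⟩ := hmono a ha hae
  obtain ⟨L₂, M₂, n₂, hL₂, hM₂, hu₂, hv₂⟩ := hmono b hb hbe
  obtain ⟨k₁, k₂, hk, hk0⟩ : ∃ k₁ k₂ : ℤ, k₁ * n₁ + k₂ * n₂ = 0 ∧ ¬ (k₁ = 0 ∧ k₂ = 0) := by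
    by_cases h : n₂ = 0 ∧ n₁ = 0
    · exact ⟨1, 0, by simp [h.2], by simp⟩
    · exact ⟨n₂, -n₁, by ring, by simpa using h⟩
  have hk' : (k₁ : ℂ) * n₁ + k₂ * n₂ = 0 := by exact_mod_cast hk
  have hlogX : LogOn (fun z => ((z - a) / (z - c)) ^ k₁ * ((z - b) / (z - c)) ^ k₂) X := by
    rw [hXins]
    refine logOn_union hX'c hEc
      (L := ContinuousMap.const ℂ (k₁ : ℂ) * L₁ + ContinuousMap.const ℂ (k₂ : ℂ) * L₂)
      (M := ContinuousMap.const ℂ (k₁ : ℂ) * M₁ + ContinuousMap.const ℂ (k₂ : ℂ) * M₂) ?_ ?_ ?_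
    · intro z hz
      simp [Complex.exp_add, Complex.exp_int_mul, hL₁ z hz, hL₂ z hz]
    · intro z hz
      simp [Complex.exp_add, Complex.exp_int_mul, hM₁ z hz, hM₂ z hz]
    · intro z hz
      rcases hinter z hz with rfl | rfl
      · simp [hu₁, hu₂]
      · simp only [ContinuousMap.add_apply, ContinuousMap.mul_apply, ContinuousMap.const_apply,
          hv₁, hv₂]
        linear_combination (2 * Real.pi * Complex.I) * hk'
  have hneU : ∀ x ∉ X, ∀ y, connectedComponentIn Xᶜ y ≠ connectedComponentIn Xᶜ x →
      ∀ z ∈ closure (connectedComponentIn Xᶜ y), z - x ≠ 0 := by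
    intro x hx y hyx z hz h
    rw [sub_eq_zero.1 h] at hz
    exact hyx (connectedComponentIn_eq
      ((closure_connectedComponentIn_compl_subset hXc y hz).resolve_right hx))
  refine hk0 ⟨?_, ?_⟩
  · have h1 := hneU b hb a hab
    have h2 := hneU c hc a hac
    refine zpow_eq_zero_of_logOn hXc ha hba
      (r := fun z => (z - c) ^ (-k₁) * ((z - b) / (z - c)) ^ k₂) ?_ ?_ (hlogX.congr fun z hz => ?_)
    · refine ContinuousOn.mul (ContinuousOn.zpow₀ (by fun_prop) _ fun z hz => Or.inl (h2 z hz))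
        (ContinuousOn.zpow₀ (ContinuousOn.div (by fun_prop) (by fun_prop) h2) _ fun z hz =>
          Or.inl (div_ne_zero (h1 z hz) (h2 z hz)))
    · exact fun z hz => mul_ne_zero (zpow_ne_zero _ (h2 z hz))
        (zpow_ne_zero _ (div_ne_zero (h1 z hz) (h2 z hz)))
    · rw [div_zpow, zpow_neg]
      ring
  · have h1 := hneU a ha b hab.symm
    have h2 := hneU c hc b hbc
    refine zpow_eq_zero_of_logOn hXc hb hbb
      (r := fun z => (z - c) ^ (-k₂) * ((z - a) / (z - c)) ^ k₁) ?_ ?_ (hlogX.congr fun z hz => ?_)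
    · refine ContinuousOn.mul (ContinuousOn.zpow₀ (by fun_prop) _ fun z hz => Or.inl (h2 z hz))
        (ContinuousOn.zpow₀ (ContinuousOn.div (by fun_prop) (by fun_prop) h2) _ fun z hz =>
          Or.inl (div_ne_zero (h1 z hz) (h2 z hz)))
    · exact fun z hz => mul_ne_zero (zpow_ne_zero _ (h2 z hz))
        (zpow_ne_zero _ (div_ne_zero (h1 z hz) (h2 z hz)))
    · rw [div_zpow (z - b), zpow_neg]
      ring

/-- The edges whose inner part meets the closure of the face of `a`. -/
def faceEdges (a : ℂ) : Set (Sym2 V) :=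
  {e | ∃ h : e ∈ G.edgeSet,
    (D.inner ⟨e, h⟩ ∩ closure (connectedComponentIn (D.carrier univ G.edgeSet)ᶜ a)).Nonempty}

/-- Each edge borders at most two faces. -/
theorem false_of_three_faces [Finite V] {e : Sym2 V} {a b c : ℂ}
    (ha : a ∉ D.carrier univ G.edgeSet) (hb : b ∉ D.carrier univ G.edgeSet)
    (hc : c ∉ D.carrier univ G.edgeSet)
    (hab : connectedComponentIn (D.carrier univ G.edgeSet)ᶜ a ≠
      connectedComponentIn (D.carrier univ G.edgeSet)ᶜ b)
    (hac : connectedComponentIn (D.carrier univ G.edgeSet)ᶜ a ≠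
      connectedComponentIn (D.carrier univ G.edgeSet)ᶜ c)
    (hbc : connectedComponentIn (D.carrier univ G.edgeSet)ᶜ b ≠
      connectedComponentIn (D.carrier univ G.edgeSet)ᶜ c)
    (hae : e ∈ D.faceEdges a) (hbe : e ∈ D.faceEdges b) (hce : e ∈ D.faceEdges c) : False := by
  obtain ⟨he, hae⟩ := hae
  obtain ⟨_, hbe⟩ := hbe
  obtain ⟨_, hce⟩ := hce
  have hX := D.isCompact_carrier univ G.edgeSet
  by_cases h1 : Bornology.IsBounded (connectedComponentIn (D.carrier univ G.edgeSet)ᶜ a)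
  · by_cases h2 : Bornology.IsBounded (connectedComponentIn (D.carrier univ G.edgeSet)ᶜ b)
    · exact D.false_of_three_faces_of_isBounded ⟨e, he⟩ ha hb hc hab hac hbc hae hbe hce h1 h2
    · exact D.false_of_three_faces_of_isBounded ⟨e, he⟩ ha hc hb hac hab hbc.symm hae hce hbe h1
        ((isBounded_or_isBounded_of_ne hX hbc).resolve_left h2)
  · exact D.false_of_three_faces_of_isBounded ⟨e, he⟩ hb hc ha hbc hab.symm hac.symm hbe hce hae
      ((isBounded_or_isBounded_of_ne hX hab).resolve_left h1)
      ((isBounded_or_isBounded_of_ne hX hac).resolve_left h1)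

/-- If the edges on the boundary of a face form a forest, they do not separate the plane, so the
face is the whole complement of the drawing and all edges are on its boundary. -/
theorem subset_faceEdges_of_isAcyclic [Finite V] {a : ℂ} (ha : a ∉ D.carrier univ G.edgeSet)
    (h : (SimpleGraph.fromEdgeSet (D.faceEdges a)).IsAcyclic) : G.edgeSet ⊆ D.faceEdges a := by
  have hFG : D.faceEdges a ⊆ G.edgeSet := fun e he => he.1
  have hedge : (SimpleGraph.fromEdgeSet (D.faceEdges a)).edgeSet = D.faceEdges a := by
    rw [SimpleGraph.edgeSet_fromEdgeSet, sdiff_eq_left, disjoint_left]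
    exact fun e he => G.not_isDiag_of_mem_edgeSet (hFG he)
  have hle : SimpleGraph.fromEdgeSet (D.faceEdges a) ≤ G := by
    rw [← SimpleGraph.edgeSet_subset_edgeSet, hedge]
    exact hFG
  have hconn := D.isPreconnected_compl_carrier_of_isAcyclic hle h
  rw [hedge] at hconn
  set X := D.carrier univ G.edgeSet with hX
  have hXc : IsClosed X := D.isClosed_carrier _ _
  set U := connectedComponentIn Xᶜ a with hU
  have hUo : IsOpen U := isOpen_connectedComponentIn_compl hXc a
  have hYX : D.carrier univ (D.faceEdges a) ⊆ X := D.carrier_mono _ hFG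
  have hfr : closure U ⊆ U ∪ D.carrier univ (D.faceEdges a) := by
    intro z hz
    rcases closure_connectedComponentIn_compl_subset hXc a hz with hzU | hzX
    · exact Or.inl hzU
    refine Or.inr ?_
    rw [hX, D.mem_carrier_iff fun _ _ v _ => mem_univ v] at hzX
    rw [D.mem_carrier_iff fun _ _ v _ => mem_univ v]
    exact hzX.imp_right fun ⟨e, _, hze⟩ => ⟨e, ⟨e.2, z, hze, hz⟩, hze⟩
  have hsub : (D.carrier univ (D.faceEdges a))ᶜ ⊆ U := by
    refine hconn.subset_left_of_subset_union hUo isClosed_closure.isOpen_compl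
      (disjoint_left.2 fun z hz hz' => hz' (subset_closure hz)) ?_ ?_
    · intro z hz
      by_cases hzU : z ∈ closure U
      · exact Or.inl ((hfr hzU).resolve_right hz)
      · exact Or.inr hzU
    · exact ⟨a, fun h => ha (hYX h), mem_connectedComponentIn ha⟩
  intro e he
  by_contra hne
  obtain ⟨z, hz⟩ : (D.inner ⟨e, he⟩).Nonempty := (nonempty_Ioo.2 zero_lt_one).image _
  have h1 : z ∉ D.carrier univ (D.faceEdges a) := D.disjoint_inner_carrier hne hz
  exact connectedComponentIn_subset _ _ (hsub h1)
    (D.range_subset_carrier he (D.inner_subset_range _ hz))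

/-- Adding edges to a spanning forest creates a new face with every edge. -/
theorem exists_faces [Finite V] {T : SimpleGraph V} (hTG : T ≤ G)
    (hTr : T.Reachable = G.Reachable) (F : Finset (Sym2 V)) (hFG : (F : Set (Sym2 V)) ⊆ G.edgeSet)
    (hFT : Disjoint (F : Set (Sym2 V)) T.edgeSet) :
    ∃ P : Finset ℂ, F.card + 1 ≤ P.card ∧
      (∀ x ∈ P, x ∉ D.carrier univ (T.edgeSet ∪ F)) ∧
      ∀ x ∈ P, ∀ y ∈ P, y ∈ connectedComponentIn (D.carrier univ (T.edgeSet ∪ F))ᶜ x → x = y := by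
  classical
  induction F using Finset.induction_on with
  | empty =>
    obtain ⟨x, hx⟩ : ∃ x, x ∉ D.carrier univ (T.edgeSet ∪ (∅ : Finset (Sym2 V))) :=
      (ne_univ_iff_exists_notMem _).1 (D.isCompact_carrier _ _).ne_univ
    exact ⟨{x}, by simp, by simpa using hx, by simp⟩
  | insert e F heF ih =>
    rw [Finset.coe_insert, insert_subset_iff] at hFG
    rw [Finset.coe_insert, disjoint_insert_left] at hFT
    obtain ⟨P, hcard, hPX, hP⟩ := ih hFG.2 hFT.2
    set E : G.edgeSet := ⟨e, hFG.1⟩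
    obtain ⟨u, v, huv, hu, hv⟩ := D.exists_ends E
    have huvG : G.Adj u v := by
      have := E.2
      rwa [huv] at this
    have heTF : (E : Sym2 V) ∉ T.edgeSet ∪ F := by
      rintro (h | h)
      exacts [hFT.1 h, heF h]
    obtain ⟨x, hx, y, hy, hex, hxy, hnxy⟩ := D.exists_split hTG subset_union_left heTF hu hv
      (hTr ▸ huvG.reachable)
    have hins : T.edgeSet ∪ ((insert e F : Finset (Sym2 V)) : Set (Sym2 V)) =
        insert (E : Sym2 V) (T.edgeSet ∪ F) := by
      rw [Finset.coe_insert, union_insert]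
    rw [hins]
    set X := D.carrier univ (T.edgeSet ∪ F) with hX
    set X' := D.carrier univ (insert (E : Sym2 V) (T.edgeSet ∪ F)) with hX'
    have hXX' : X ⊆ X' := D.carrier_mono _ (subset_insert _ _)
    have hXX'c : X'ᶜ ⊆ Xᶜ := compl_subset_compl.2 hXX'
    have hsame : ∀ z w, w ∈ connectedComponentIn X'ᶜ z → w ∈ connectedComponentIn Xᶜ z :=
      fun z w hw => connectedComponentIn_mono z hXX'c hw
    have hX'eq : X' = X ∪ range (D.path E) := D.carrier_insert _ _ E
    -- the faces other than the one that is split are not met by the new edge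
    have hnmem : ∀ z ∉ X, z ∉ connectedComponentIn Xᶜ x → z ∉ X' := by
      intro z hz hzx hz'
      rw [hX'eq] at hz'
      rcases D.range_path_subset hu hv (hz'.resolve_left hz) with h | ⟨w, -, rfl⟩
      · exact hzx (hex h)
      · exact hz (D.pt_mem_carrier _ (mem_univ w))
    set P' := P.filter fun z => z ∉ connectedComponentIn Xᶜ x with hP'
    have hPle : P.card ≤ P'.card + 1 := by
      rw [← Finset.card_filter_add_card_filter_not (s := P) fun z => z ∉ connectedComponentIn Xᶜ x]
      refine Nat.add_le_add_left (Finset.card_le_one.2 fun z hz w hw => ?_) _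
      rw [Finset.mem_filter, not_not] at hz hw
      refine hP z hz.1 w hw.1 ?_
      rw [← connectedComponentIn_eq hz.2]
      exact hw.2
    have hxX : x ∈ Xᶜ := hXX'c hx
    have hyP : y ∉ P' := fun h => (Finset.mem_filter.1 h).2 hxy
    have hxP : x ∉ insert y P' := by
      rw [Finset.mem_insert]
      rintro (rfl | h)
      · exact hnxy (mem_connectedComponentIn hx)
      · exact (Finset.mem_filter.1 h).2 (mem_connectedComponentIn hxX)
    have hsymm : ∀ z ∈ X'ᶜ, ∀ w, w ∈ connectedComponentIn X'ᶜ z →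
        z ∈ connectedComponentIn X'ᶜ w := by
      intro z hz w hw
      rw [← connectedComponentIn_eq hw]
      exact mem_connectedComponentIn hz
    have hold : ∀ z ∈ P', ∀ w, (w = x ∨ w = y) → z ∉ connectedComponentIn X'ᶜ w := by
      rintro z hz w hw hzw
      have h1 := hsame _ _ hzw
      refine (Finset.mem_filter.1 hz).2 ?_
      rcases hw with rfl | rfl
      · exact h1
      · rwa [connectedComponentIn_eq hxy]
    have hmem : ∀ z ∈ insert x (insert y P'), z ∉ X' := by
      intro z hz
      rw [Finset.mem_insert, Finset.mem_insert] at hz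
      rcases hz with rfl | rfl | hz
      · exact hx
      · exact hy
      · exact hnmem z (hPX z (Finset.mem_filter.1 hz).1) (Finset.mem_filter.1 hz).2
    refine ⟨insert x (insert y P'), ?_, hmem, ?_⟩
    · rw [Finset.card_insert_of_notMem hxP, Finset.card_insert_of_notMem hyP,
        Finset.card_insert_of_notMem heF]
      omega
    · intro z hz w hw hzw
      have hwz := hsymm z (hmem z hz) w hzw
      rw [Finset.mem_insert, Finset.mem_insert, ← or_assoc] at hz hw
      rcases hz with hz | hz <;> rcases hw with hw | hw
      · rcases hz with rfl | rfl <;> rcases hw with rfl | rfl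
        exacts [rfl, absurd hzw hnxy, absurd hwz hnxy, rfl]
      · exact absurd hzw (hold w hw z hz)
      · exact absurd hwz (hold z hz w hw)
      · exact hP z (Finset.mem_filter.1 hz).1 w (Finset.mem_filter.1 hw).1 (hsame z w hzw)

end PlaneDrawing

/-! ### The number of edges of a triangle-free planar graph -/

theorem card_edges_lt_of_isAcyclic {V : Type*} [Fintype V] [Nonempty V] {T : SimpleGraph V}
    (hT : T.IsAcyclic) : T.edgeSet.ncard + 1 ≤ Fintype.card V := by
  classical
  obtain ⟨S, hTS, -, hS⟩ := SimpleGraph.connected_top.exists_isTree_le_of_le_of_isAcyclic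
    (le_top (a := T)) hT
  have h1 := hS.card_edgeFinset
  have h2 : T.edgeSet.ncard ≤ S.edgeSet.ncard :=
    ncard_le_ncard (SimpleGraph.edgeSet_mono hTS) (toFinite _)
  rw [← SimpleGraph.coe_edgeFinset S, ncard_coe_finset] at h2
  omega

/-- In a triangle-free graph, a set of edges that is not a forest has at least four elements. -/
theorem four_le_ncard_of_not_isAcyclic {V : Type*} [Finite V] {G : SimpleGraph V}
    (hG : ∀ a b c, G.Adj a b → G.Adj b c → ¬ G.Adj c a) {F : Set (Sym2 V)} (hF : F ⊆ G.edgeSet)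
    (h : ¬ (SimpleGraph.fromEdgeSet F).IsAcyclic) : 4 ≤ F.ncard := by
  classical
  have hadj : ∀ {a b}, (SimpleGraph.fromEdgeSet F).Adj a b → G.Adj a b := fun h =>
    hF ((SimpleGraph.fromEdgeSet_adj F).1 h).1
  simp only [SimpleGraph.IsAcyclic, not_forall, not_not] at h
  obtain ⟨v, c, hc⟩ := h
  have hsub : (c.edges.toFinset : Set (Sym2 V)) ⊆ F := by
    intro e he
    have := c.edges_subset_edgeSet (List.mem_toFinset.1 he)
    rw [SimpleGraph.edgeSet_fromEdgeSet] at this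
    exact this.1
  have h1 : c.edges.toFinset.card = c.length := by
    rw [List.toFinset_card_of_nodup hc.edges_nodup, SimpleGraph.Walk.length_edges]
  have h2 := ncard_le_ncard hsub (toFinite _)
  rw [ncard_coe_finset, h1] at h2
  refine le_trans ?_ h2
  have h3 := hc.three_le_length
  by_contra hlt
  have h4 : c.length = 3 := by omega
  match c, h4 with
  | .cons h₁ (.cons h₂ (.cons h₃ .nil)), _ => exact hG _ _ _ (hadj h₁) (hadj h₂) (hadj h₃)

/-- Every face of a triangle-free plane graph with a cycle has at least four edges, each edge
borders at most two faces, and a spanning forest shows that there are at least `E - V + 2` faces. -/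
theorem card_edges_add_four_le {V : Type*} [Fintype V] {G : SimpleGraph V} (hP : IsPlanar G)
    (hG : ∀ a b c, G.Adj a b → G.Adj b c → ¬ G.Adj c a) (hcyc : ¬ G.IsAcyclic) :
    G.edgeSet.ncard + 4 ≤ 2 * Fintype.card V := by
  classical
  obtain ⟨D⟩ := hP
  have hV : Nonempty V := by
    by_contra hV
    rw [not_nonempty_iff] at hV
    exact hcyc fun v => isEmptyElim v
  obtain ⟨T, hTG, hT, hTr⟩ := G.exists_isAcyclic_reachable_eq_le
  have hTcard := card_edges_lt_of_isAcyclic hT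
  set F : Finset (Sym2 V) := (G.edgeSet \ T.edgeSet).toFinset with hFdef
  have hF : (F : Set (Sym2 V)) = G.edgeSet \ T.edgeSet := coe_toFinset _
  have hTF : T.edgeSet ∪ F = G.edgeSet := by
    rw [hF, union_sdiff_cancel (SimpleGraph.edgeSet_mono hTG)]
  have hcard : T.edgeSet.ncard + F.card = G.edgeSet.ncard := by
    rw [← ncard_coe_finset, hF, add_comm]
    exact ncard_sdiff_add_ncard_of_subset (SimpleGraph.edgeSet_mono hTG)
  obtain ⟨P, hPcard, hPX, hPne⟩ := D.exists_faces hTG hTr F (hF ▸ sdiff_subset)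
    (hF ▸ disjoint_sdiff_left)
  rw [hTF] at hPX hPne
  have hcomp : ∀ x ∈ P, ∀ y ∈ P, x ≠ y → connectedComponentIn (D.carrier univ G.edgeSet)ᶜ x ≠
      connectedComponentIn (D.carrier univ G.edgeSet)ᶜ y := by
    intro x hx y hy hxy h
    exact hxy (hPne x hx y hy (h ▸ mem_connectedComponentIn (hPX y hy)))
  have hcount := Finset.card_mul_le_card_mul (s := P) (t := G.edgeSet.toFinset) (m := 4) (n := 2)
    (fun x e => e ∈ D.faceEdges x) ?_ ?_
  · have : G.edgeSet.toFinset.card = G.edgeSet.ncard := (ncard_eq_toFinset_card' _).symm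
    omega
  · intro x hx
    have h4 : 4 ≤ (D.faceEdges x).ncard := by
      refine four_le_ncard_of_not_isAcyclic hG (fun e he => he.1) fun hac => hcyc ?_
      refine hac.anti fun a b hab => ?_
      rw [SimpleGraph.fromEdgeSet_adj]
      exact ⟨D.subset_faceEdges_of_isAcyclic (hPX x hx) hac hab, hab.ne⟩
    refine h4.trans_eq ?_
    rw [← ncard_coe_finset]
    congr 1
    ext e
    simp only [Finset.coe_bipartiteAbove, mem_toFinset]
    exact ⟨fun h => ⟨h.1, h⟩, fun h => h.2⟩
  · intro e he
    by_contra! h3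
    obtain ⟨a, b, c, ha, hb, hc, hab, hac, hbc⟩ := Finset.two_lt_card_iff.1 h3
    rw [Finset.mem_bipartiteBelow] at ha hb hc
    exact D.false_of_three_faces (hPX a ha.1) (hPX b hb.1) (hPX c hc.1)
      (hcomp a ha.1 b hb.1 hab) (hcomp a ha.1 c hc.1 hac) (hcomp b hb.1 c hc.1 hbc) ha.2 hb.2 hc.2

/-! ### Planar subgraphs and the complete bipartite graphs -/

/-- A drawing of a graph contains drawings of the graphs that embed into it. -/
theorem IsPlanar.of_copy {V W : Type*} {G : SimpleGraph V} {H : SimpleGraph W} (hG : IsPlanar G)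
    (f : W → V) (hf : Function.Injective f) (hadj : ∀ a b, H.Adj a b → G.Adj (f a) (f b)) :
    IsPlanar H := by
  obtain ⟨D⟩ := hG
  have hmem : ∀ e : H.edgeSet, Sym2.map f e ∈ G.edgeSet := by
    rintro ⟨e, he⟩
    induction e using Sym2.ind with
    | _ a b => exact hadj a b he
  exact ⟨{
    point := fun w => D.point (f w)
    arc := fun e => D.arc ⟨Sym2.map f e, hmem e⟩
    point_injective := D.point_injective.comp hf
    arc_injective := fun e => D.arc_injective _
    arc_ends := fun e => by
      rw [D.arc_ends]
      exact Sym2.map_map _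
    arc_ne_point := fun e t ht v => D.arc_ne_point _ t ht _
    arc_ne_arc := fun e e' hne => D.arc_ne_arc _ _ fun h =>
      hne (Subtype.ext (Sym2.map.injective hf (congrArg Subtype.val h))) }⟩

/-- In a triangle-free planar graph, three vertices do not have three common neighbours. -/
theorem false_of_isPlanar_of_adj {V : Type*} {G : SimpleGraph V} (hP : IsPlanar G)
    (a b : Fin 3 → V) (ha : Function.Injective a) (hb : Function.Injective b)
    (hab : ∀ i j, G.Adj (a i) (b j)) : False := by
  have hK : IsPlanar (completeBipartiteGraph (Fin 3) (Fin 3)) := by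
    refine hP.of_copy (Sum.elim a b) (ha.sumElim hb fun i j => (hab i j).ne) ?_
    rintro (i | i) (j | j) h
    · simp at h
    · exact hab i j
    · exact (hab j i).symm
    · simp at h
  have hE : (completeBipartiteGraph (Fin 3) (Fin 3)).edgeSet.ncard = 9 := by
    rw [ncard_def, SimpleGraph.encard_edgeSet_completeBipartiteGraph]
    simp
  have hac : ¬ (completeBipartiteGraph (Fin 3) (Fin 3)).IsAcyclic := fun h => by
    have := card_edges_lt_of_isAcyclic h
    rw [hE] at this
    simp at this
  have := card_edges_add_four_le hK (by
    rintro (a | a) (b | b) (c | c) <;> simp) hac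
  rw [hE] at this
  simp at this

/-- A triangle-free planar graph has a vertex of degree at most three. -/
theorem exists_degree_le_three {V : Type*} [Fintype V] [Nonempty V] {G : SimpleGraph V}
    [DecidableRel G.Adj] (hP : IsPlanar G)
    (hG : ∀ a b c, G.Adj a b → G.Adj b c → ¬ G.Adj c a) : ∃ v, G.degree v ≤ 3 := by
  classical
  by_contra! h
  have h1 := G.sum_degrees_eq_twice_card_edges
  have h2 : Fintype.card V * 4 ≤ ∑ v, G.degree v := by
    rw [← smul_eq_mul, ← Finset.card_univ]
    exact Finset.card_nsmul_le_sum _ _ _ fun v _ => h v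
  have h3 : G.edgeSet.ncard = G.edgeFinset.card := by
    rw [← SimpleGraph.coe_edgeFinset, ncard_coe_finset]
  have hac : ¬ G.IsAcyclic := fun hac => by
    have := card_edges_lt_of_isAcyclic hac
    omega
  have := card_edges_add_four_le hP hG hac
  omega

/-- The complete bipartite graph with two vertices on one side, drawn with these two vertices at
`(0, 1)` and `(0, -1)`, with the others on the horizontal axis and with segments as edges. -/
theorem isPlanar_completeBipartiteGraph_two (m : ℕ) :
    IsPlanar (completeBipartiteGraph (Fin 2) (Fin m)) := by
  have hends : ∀ e : (completeBipartiteGraph (Fin 2) (Fin m)).edgeSet, ∃ (j : Fin 2) (i : Fin m),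
      (e : Sym2 (Fin 2 ⊕ Fin m)) = s(Sum.inl j, Sum.inr i) := by
    rintro ⟨e, he⟩
    induction e using Sym2.ind with
    | _ a b =>
      rcases a with a | a <;> rcases b with b | b
      · simp at he
      · exact ⟨a, b, rfl⟩
      · exact ⟨b, a, Sym2.eq_swap⟩
      · simp at he
  choose j i hji using hends
  set σ : Fin 2 → ℝ := ![1, -1] with hσ
  have hσ0 : ∀ k, σ k = 1 ∨ σ k = -1 := by
    intro k
    fin_cases k <;> simp [hσ]
  have hσi : ∀ k l (s t : ℝ), 0 < s → 0 < t → s * σ k = t * σ l → k = l ∧ s = t := by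
    intro k l s t hs ht h
    have : k = l := by
      fin_cases k <;> fin_cases l <;> simp [hσ] at h ⊢ <;> linarith
    subst this
    refine ⟨rfl, ?_⟩
    rcases hσ0 k with h0 | h0 <;> rw [h0] at h <;> linarith
  set P : Fin 2 ⊕ Fin m → EuclideanSpace ℝ (Fin 2) :=
    Sum.elim (fun k => !₂[0, σ k]) (fun k => !₂[(k : ℝ), 0]) with hPdef
  have hPr0 : ∀ k, P (Sum.inl k) 0 = 0 := fun k => by simp [hPdef]
  have hPr1 : ∀ k, P (Sum.inl k) 1 = σ k := fun k => by simp [hPdef]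
  have hPl0 : ∀ k, P (Sum.inr k) 0 = (k : ℝ) := fun k => by simp [hPdef]
  have hPl1 : ∀ k, P (Sum.inr k) 1 = 0 := fun k => by simp [hPdef]
  set γ : (completeBipartiteGraph (Fin 2) (Fin m)).edgeSet →
      C(unitInterval, EuclideanSpace ℝ (Fin 2)) := fun e =>
    ⟨fun t => (1 - (t : ℝ)) • P (Sum.inl (j e)) + (t : ℝ) • P (Sum.inr (i e)), by fun_prop⟩
    with hγ
  have hγ0 : ∀ e t, γ e t 0 = (t : ℝ) * (i e : ℝ) := fun e t => by simp [hγ, hPr0, hPl0]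
  have hγ1 : ∀ e t, γ e t 1 = (1 - (t : ℝ)) * σ (j e) := fun e t => by simp [hγ, hPr1, hPl1]
  refine ⟨{
    point := P
    arc := γ
    point_injective := ?_
    arc_injective := ?_
    arc_ends := ?_
    arc_ne_point := ?_
    arc_ne_arc := ?_ }⟩
  · rintro (a | a) (b | b) h
    · have := congrArg (fun p : EuclideanSpace ℝ (Fin 2) => p 1) h
      simp only [hPr1] at this
      rw [(hσi a b 1 1 one_pos one_pos (by rw [this])).1]
    · have := congrArg (fun p : EuclideanSpace ℝ (Fin 2) => p 1) h
      simp only [hPr1, hPl1] at this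
      rcases hσ0 a with h0 | h0 <;> rw [h0] at this <;> norm_num at this
    · have := congrArg (fun p : EuclideanSpace ℝ (Fin 2) => p 1) h
      simp only [hPr1, hPl1] at this
      rcases hσ0 b with h0 | h0 <;> rw [h0] at this <;> norm_num at this
    · have := congrArg (fun p : EuclideanSpace ℝ (Fin 2) => p 0) h
      simp only [hPl0, Nat.cast_inj] at this
      rw [Fin.ext this]
  · intro e s t h
    have := congrArg (fun p : EuclideanSpace ℝ (Fin 2) => p 1) h
    simp only [hγ1] at this
    refine Subtype.ext ?_
    rcases hσ0 (j e) with h0 | h0 <;> rw [h0] at this <;> linarith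
  · intro e
    rw [hji e, Sym2.map_mk]
    simp [hγ]
  · rintro e t ht (a | a) h
    · have h1 := congrArg (fun p : EuclideanSpace ℝ (Fin 2) => p 1) h
      simp only [hγ1, hPr1] at h1
      have := (hσi (j e) a (1 - t) 1 (sub_pos.2 ht.2) one_pos (by rw [h1, one_mul])).2
      have ht0 : (0 : ℝ) < t := ht.1
      linarith
    · have h1 := congrArg (fun p : EuclideanSpace ℝ (Fin 2) => p 1) h
      simp only [hγ1, hPl1] at h1
      have ht1 : (t : ℝ) < 1 := ht.2
      rcases hσ0 (j e) with h0 | h0 <;> rw [h0] at h1 <;> linarith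
  · intro e e' hne t ht t' ht' h
    have h0 := congrArg (fun p : EuclideanSpace ℝ (Fin 2) => p 0) h
    have h1 := congrArg (fun p : EuclideanSpace ℝ (Fin 2) => p 1) h
    simp only [hγ0] at h0
    simp only [hγ1] at h1
    obtain ⟨hj, htt⟩ := hσi (j e) (j e') (1 - t) (1 - t') (sub_pos.2 ht.2) (sub_pos.2 ht'.2) h1
    have htt' : (t : ℝ) = t' := by linarith
    have ht0 : (t : ℝ) ≠ 0 := (show (0 : ℝ) < t from ht.1).ne'
    rw [← htt', mul_right_inj' ht0, Nat.cast_inj] at h0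
    refine hne (Subtype.ext ?_)
    rw [hji e, hji e', hj, Fin.ext h0]

/-- `G` is the complete bipartite graph between `{x, y}` and the other vertices. -/
def IsCompleteBipartiteTwo {V : Type*} (G : SimpleGraph V) (x y : V) : Prop :=
  x ≠ y ∧ ∀ a b, G.Adj a b ↔ ((a = x ∨ a = y) ∧ ¬ (b = x ∨ b = y)) ∨
    (¬ (a = x ∨ a = y) ∧ (b = x ∨ b = y))

theorem nonempty_iso_completeBipartiteGraph_iff {V : Type*} [Fintype V] (G : SimpleGraph V) {n : ℕ}
    (hn : Fintype.card V = n) :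
    Nonempty (G ≃g completeBipartiteGraph (Fin 2) (Fin (n - 2))) ↔
      ∃ x y, IsCompleteBipartiteTwo G x y := by
  classical
  constructor
  · rintro ⟨φ⟩
    refine ⟨φ.symm (Sum.inl 0), φ.symm (Sum.inl 1), by simp, fun a b => ?_⟩
    rw [← φ.map_adj_iff]
    have h : ∀ c : V, (c = φ.symm (Sum.inl 0) ∨ c = φ.symm (Sum.inl 1)) ↔ (φ c).isLeft := by
      intro c
      obtain ⟨c, rfl⟩ := φ.symm.surjective c
      simp only [φ.symm.injective.eq_iff, RelIso.apply_symm_apply]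
      rcases c with c | c
      · fin_cases c <;> simp
      · simp
    rw [h, h, completeBipartiteGraph_adj]
    rcases φ a with a | a <;> rcases φ b with b | b <;> simp
  · rintro ⟨x, y, hxy, h⟩
    have h1 : Fintype.card {v // v = x ∨ v = y} = 2 := by
      rw [Fintype.card_subtype]
      have : Finset.univ.filter (fun v => v = x ∨ v = y) = {x, y} := by ext; simp
      rw [this, Finset.card_pair hxy]
    have h2 : Fintype.card {v // ¬ (v = x ∨ v = y)} = n - 2 := by
      rw [Fintype.card_subtype_compl, h1, hn]
    set e : V ≃ Fin 2 ⊕ Fin (n - 2) := (Equiv.sumCompl fun v => v = x ∨ v = y).symm.trans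
      (Equiv.sumCongr (Fintype.equivFinOfCardEq h1) (Fintype.equivFinOfCardEq h2)) with he
    have hl : ∀ v, (e v).isLeft ↔ (v = x ∨ v = y) := by
      intro v
      by_cases hv : v = x ∨ v = y
      · simp [he, hv]
      · simp [he, hv]
    refine ⟨⟨e, fun {a b} => ?_⟩⟩
    rw [h, ← hl, ← hl, completeBipartiteGraph_adj]
    rcases e a with a | a <;> rcases e b with b | b <;> simp

/-! ### Four-cycles in triangle-free graphs -/

theorem free_cycleGraph_three_iff {V : Type*} {G : SimpleGraph V} :
    (SimpleGraph.cycleGraph 3).Free G ↔ ∀ a b c, G.Adj a b → G.Adj b c → ¬ G.Adj c a := by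
  rw [SimpleGraph.Free, not_iff_comm]
  push Not
  constructor
  · rintro ⟨a, b, c, hab, hbc, hca⟩
    refine ⟨⟨⟨![a, b, c], fun {i j} hij => ?_⟩, ?_⟩⟩
    · rw [SimpleGraph.cycleGraph_three_eq_top, SimpleGraph.top_adj] at hij
      fin_cases i <;> fin_cases j <;> simp_all [SimpleGraph.adj_comm]
    · intro i j hij
      have := hab.ne
      have := hbc.ne
      have := hca.ne
      fin_cases i <;> fin_cases j <;> simp_all
  · rintro ⟨f⟩
    have h : ∀ i j : Fin 3, i ≠ j → G.Adj (f i) (f j) := fun i j hij =>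
      f.toHom.map_adj (by rwa [SimpleGraph.cycleGraph_three_eq_top, SimpleGraph.top_adj])
    exact ⟨f 0, f 1, f 2, h 0 1 (by decide), h 1 2 (by decide), h 2 0 (by decide)⟩

/-- `Q` is the set of vertices of a cycle of length four in `G`. -/
def IsFourCycle {V : Type*} [DecidableEq V] (G : SimpleGraph V) (Q : Finset V) : Prop :=
  ∃ a b c d, G.Adj a b ∧ G.Adj b c ∧ G.Adj c d ∧ G.Adj d a ∧ a ≠ c ∧ b ≠ d ∧ Q = {a, b, c, d}

open scoped Classical in
/-- The vertex sets of the cycles of length four in `G`. -/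
noncomputable def fourCycles {V : Type*} [Fintype V] [DecidableEq V] (G : SimpleGraph V) :
    Finset (Finset V) :=
  Finset.univ.filter (IsFourCycle G)

theorem mem_fourCycles {V : Type*} [Fintype V] [DecidableEq V] {G : SimpleGraph V} {Q : Finset V} :
    Q ∈ fourCycles G ↔ IsFourCycle G Q := by
  simp [fourCycles]

/-- A copy of `C₄` in a triangle-free graph is an induced subgraph, since a chord of a four-cycle
creates a triangle. -/
theorem adj_of_iso_cycleGraph_four {V : Type*} {G : SimpleGraph V}
    (hG : ∀ a b c, G.Adj a b → G.Adj b c → ¬ G.Adj c a) {H : G.Subgraph}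
    (φ : SimpleGraph.cycleGraph 4 ≃g H.coe) {x y : V} (hx : x ∈ H.verts) (hy : y ∈ H.verts)
    (hxy : G.Adj x y) : H.Adj x y := by
  obtain ⟨i, hi⟩ := φ.surjective ⟨x, hx⟩
  obtain ⟨j, hj⟩ := φ.surjective ⟨y, hy⟩
  have hadj : ∀ k l, (SimpleGraph.cycleGraph 4).Adj k l → H.Adj (φ k) (φ l) :=
    fun k l h => φ.map_adj_iff.2 h
  have hcases : ∀ i j : Fin 4, i = j ∨ (SimpleGraph.cycleGraph 4).Adj i j ∨
      ∃ k, (SimpleGraph.cycleGraph 4).Adj i k ∧ (SimpleGraph.cycleGraph 4).Adj k j := by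
    decide
  rcases hcases i j with h | h | ⟨k, h1, h2⟩
  · subst h
    rw [hi] at hj
    exact absurd (congrArg Subtype.val hj) hxy.ne
  · have := hadj i j h
    rwa [hi, hj] at this
  · have h3 := (hadj i k h1).adj_sub
    have h4 := (hadj k j h2).adj_sub
    rw [hi] at h3
    rw [hj] at h4
    exact absurd hxy.symm (hG _ _ _ h3 h4)

theorem injective_vecCons_four {V : Type*} {a b c d : V} (hab : a ≠ b) (hac : a ≠ c) (had : a ≠ d)
    (hbc : b ≠ c) (hbd : b ≠ d) (hcd : c ≠ d) :
    Function.Injective (![a, b, c, d] : Fin 4 → V) := by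
  intro i j hij
  fin_cases i <;> fin_cases j <;>
    simp [hab, hac, had, hbc, hbd, hcd, hab.symm, hac.symm, had.symm, hbc.symm, hbd.symm,
      hcd.symm] at hij ⊢

/-- Four vertices on a cycle span a copy of `C₄`. -/
theorem exists_copy_cycleGraph_four {V : Type*} {G : SimpleGraph V} {a b c d : V}
    (hab : G.Adj a b) (hbc : G.Adj b c) (hcd : G.Adj c d) (hda : G.Adj d a) (hac : a ≠ c)
    (hbd : b ≠ d) : ∃ f : SimpleGraph.Copy (SimpleGraph.cycleGraph 4) G,
      ∀ i, f.toHom i = (![a, b, c, d] : Fin 4 → V) i := by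
  have hC4 : ∀ i j : Fin 4, (SimpleGraph.cycleGraph 4).Adj i j →
      (i = 0 ∧ j = 1) ∨ (i = 1 ∧ j = 0) ∨ (i = 1 ∧ j = 2) ∨ (i = 2 ∧ j = 1) ∨
      (i = 2 ∧ j = 3) ∨ (i = 3 ∧ j = 2) ∨ (i = 3 ∧ j = 0) ∨ (i = 0 ∧ j = 3) := by
    decide
  refine ⟨⟨⟨![a, b, c, d], fun {i j} hij => ?_⟩, injective_vecCons_four hab.ne hac hda.ne.symm
    hbc.ne hbd hcd.ne⟩, fun _ => rfl⟩
  rcases hC4 i j hij with ⟨rfl, rfl⟩ | ⟨rfl, rfl⟩ | ⟨rfl, rfl⟩ | ⟨rfl, rfl⟩ | ⟨rfl, rfl⟩ |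
    ⟨rfl, rfl⟩ | ⟨rfl, rfl⟩ | ⟨rfl, rfl⟩
  exacts [hab, hab.symm, hbc, hbc.symm, hcd, hcd.symm, hda, hda.symm]

theorem copyCount_cycleGraph_four {V : Type*} [Fintype V] [DecidableEq V] {G : SimpleGraph V}
    (hG : ∀ a b c, G.Adj a b → G.Adj b c → ¬ G.Adj c a) :
    G.copyCount (SimpleGraph.cycleGraph 4) = (fourCycles G).card := by
  classical
  rw [SimpleGraph.copyCount]
  refine Finset.card_bij (fun H _ => H.verts.toFinset) ?_ ?_ ?_
  · intro H hH
    obtain ⟨φ⟩ := (Finset.mem_filter.1 hH).2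
    rw [mem_fourCycles]
    have hadj : ∀ k l, (SimpleGraph.cycleGraph 4).Adj k l → G.Adj (φ k) (φ l) :=
      fun k l h => (show H.Adj (φ k) (φ l) from φ.map_adj_iff.2 h).adj_sub
    refine ⟨φ 0, φ 1, φ 2, φ 3, hadj _ _ (by decide), hadj _ _ (by decide), hadj _ _ (by decide),
      hadj _ _ (by decide), fun h => ?_, fun h => ?_, ?_⟩
    · exact absurd (φ.injective (Subtype.ext h)) (by decide)
    · exact absurd (φ.injective (Subtype.ext h)) (by decide)
    · ext x
      rw [mem_toFinset]
      simp only [Finset.mem_insert, Finset.mem_singleton]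
      constructor
      · intro hx
        obtain ⟨i, hi⟩ := φ.surjective ⟨x, hx⟩
        have hi : (φ i : V) = x := congrArg Subtype.val hi
        rw [← hi]
        fin_cases i <;> simp
      · rintro (rfl | rfl | rfl | rfl) <;> exact (φ _).2
  · intro H hH H' hH' h
    obtain ⟨φ⟩ := (Finset.mem_filter.1 hH).2
    obtain ⟨φ'⟩ := (Finset.mem_filter.1 hH').2
    have hv : H.verts = H'.verts := toFinset_inj.1 h
    refine SimpleGraph.Subgraph.ext hv ?_
    ext x y
    constructor
    · intro hxy
      exact adj_of_iso_cycleGraph_four hG φ' (hv ▸ hxy.fst_mem) (hv ▸ hxy.snd_mem) hxy.adj_sub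
    · intro hxy
      exact adj_of_iso_cycleGraph_four hG φ (hv ▸ hxy.fst_mem) (hv ▸ hxy.snd_mem) hxy.adj_sub
  · intro Q hQ
    obtain ⟨a, b, c, d, hab, hbc, hcd, hda, hac, hbd, rfl⟩ := mem_fourCycles.1 hQ
    obtain ⟨f, hf⟩ := exists_copy_cycleGraph_four hab hbc hcd hda hac hbd
    have hmem : Nonempty (SimpleGraph.cycleGraph 4 ≃g f.toSubgraph.coe) := ⟨f.isoToSubgraph⟩
    refine ⟨f.toSubgraph, ?_, ?_⟩
    · rw [Finset.mem_filter]
      exact ⟨@Finset.mem_univ _ (_) _, hmem⟩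
    ext x
    rw [mem_toFinset]
    simp only [SimpleGraph.Subgraph.map_verts, SimpleGraph.Subgraph.verts_top, image_univ,
      Finset.mem_insert, Finset.mem_singleton, mem_range]
    rw [exists_congr fun i => by rw [hf i]]
    simp [Fin.exists_fin_succ, eq_comm]

/-- The four-cycles that avoid a vertex `v` are those of the graph without `v`. -/
theorem card_fourCycles_le {V : Type*} [Fintype V] [DecidableEq V] (G : SimpleGraph V) (v : V) :
    (fourCycles G).card ≤ (fourCycles (G.comap (Subtype.val : {w // w ≠ v} → V))).card +
      ((fourCycles G).filter (v ∈ ·)).card := by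
  rw [← Finset.card_filter_add_card_filter_not (s := fourCycles G) (v ∈ ·), add_comm]
  refine Nat.add_le_add_right ?_ _
  refine le_trans (Finset.card_le_card (t := (fourCycles (G.comap
    (Subtype.val : {w // w ≠ v} → V))).image fun Q => Q.image Subtype.val) ?_)
    Finset.card_image_le
  intro Q hQ
  rw [Finset.mem_filter, mem_fourCycles] at hQ
  obtain ⟨⟨a, b, c, d, hab, hbc, hcd, hda, hac, hbd, rfl⟩, hv⟩ := hQ
  simp only [Finset.mem_insert, Finset.mem_singleton, not_or] at hv
  obtain ⟨ha, hb, hc, hd⟩ := hv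
  refine Finset.mem_image.2 ⟨{⟨a, Ne.symm ha⟩, ⟨b, Ne.symm hb⟩, ⟨c, Ne.symm hc⟩, ⟨d, Ne.symm hd⟩},
    mem_fourCycles.2 ⟨⟨a, Ne.symm ha⟩, ⟨b, Ne.symm hb⟩, ⟨c, Ne.symm hc⟩, ⟨d, Ne.symm hd⟩, hab, hbc,
      hcd, hda, ?_, ?_, rfl⟩, by simp [Finset.image_insert]⟩
  · simpa using hac
  · simpa using hbd

section

variable {V : Type*} [Fintype V] [DecidableEq V] (G : SimpleGraph V) [DecidableRel G.Adj]

/-- A four-cycle through `v` is determined by the vertex `u` opposite to `v` and two common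
neighbours of `u` and `v`. -/
theorem card_filter_fourCycles_le (hG : ∀ a b c, G.Adj a b → G.Adj b c → ¬ G.Adj c a) (v : V) :
    ((fourCycles G).filter (v ∈ ·)).card ≤ ∑ u ∈ (insert v (G.neighborFinset v))ᶜ,
      (G.neighborFinset u ∩ G.neighborFinset v).card.choose 2 := by
  have key : ∀ b c d, G.Adj v b → G.Adj b c → G.Adj c d → G.Adj d v → v ≠ c → b ≠ d →
      insert v (insert c {b, d}) ∈ (insert v (G.neighborFinset v))ᶜ.biUnion fun u =>
        ((G.neighborFinset u ∩ G.neighborFinset v).powersetCard 2).image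
          fun P => insert v (insert u P) := by
    intro b c d hvb hbc hcd hdv hvc hbd
    rw [Finset.mem_biUnion]
    refine ⟨c, ?_, Finset.mem_image.2 ⟨{b, d}, Finset.mem_powersetCard.2 ⟨?_,
      Finset.card_pair hbd⟩, rfl⟩⟩
    · rw [Finset.mem_compl, Finset.mem_insert, SimpleGraph.mem_neighborFinset, not_or]
      exact ⟨hvc.symm, fun h => hG _ _ _ hvb hbc h.symm⟩
    · intro w hw
      rw [Finset.mem_insert, Finset.mem_singleton] at hw
      rw [Finset.mem_inter, SimpleGraph.mem_neighborFinset, SimpleGraph.mem_neighborFinset]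
      rcases hw with rfl | rfl
      exacts [⟨hbc.symm, hvb⟩, ⟨hcd, hdv.symm⟩]
  have hsub : (fourCycles G).filter (v ∈ ·) ⊆ (insert v (G.neighborFinset v))ᶜ.biUnion fun u =>
      ((G.neighborFinset u ∩ G.neighborFinset v).powersetCard 2).image
        fun P => insert v (insert u P) := by
    intro Q hQ
    rw [Finset.mem_filter, mem_fourCycles] at hQ
    obtain ⟨⟨a, b, c, d, hab, hbc, hcd, hda, hac, hbd, rfl⟩, hv⟩ := hQ
    simp only [Finset.mem_insert, Finset.mem_singleton] at hv
    rcases hv with rfl | rfl | rfl | rfl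
    · convert key b c d hab hbc hcd hda hac hbd using 1
      ext; simp; tauto
    · convert key c d a hbc hcd hda hab hbd hac.symm using 1
      ext; simp; tauto
    · convert key d a b hcd hda hab hbc hac.symm hbd.symm using 1
      ext; simp; tauto
    · convert key a b c hda hab hbc hcd hbd.symm hac using 1
      ext; simp; tauto
  refine (Finset.card_le_card hsub).trans (Finset.card_biUnion_le.trans
    (Finset.sum_le_sum fun u _ => ?_))
  exact Finset.card_image_le.trans (Finset.card_powersetCard _ _).le

theorem card_compl_insert_neighborFinset (v : V) :
    (insert v (G.neighborFinset v))ᶜ.card = Fintype.card V - 1 - G.degree v := by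
  rw [Finset.card_compl, Finset.card_insert_of_notMem (by simp),
    SimpleGraph.card_neighborFinset_eq_degree]
  omega

/-- A vertex of degree at most two is in at most `n - 3` four-cycles. -/
theorem card_filter_fourCycles_le_of_degree_le_two
    (hG : ∀ a b c, G.Adj a b → G.Adj b c → ¬ G.Adj c a) (hn : 4 ≤ Fintype.card V) {v : V}
    (hv : G.degree v ≤ 2) :
    ((fourCycles G).filter (v ∈ ·)).card ≤ Fintype.card V - 3 ∧
      (((fourCycles G).filter (v ∈ ·)).card = Fintype.card V - 3 →
        ∃ x y, IsCompleteBipartiteTwo G x y) := by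
  have hsum := card_filter_fourCycles_le G hG v
  have hcard := card_compl_insert_neighborFinset G v
  have hle2 : ∀ u, (G.neighborFinset u ∩ G.neighborFinset v).card ≤ G.degree v := fun u =>
    Finset.card_le_card Finset.inter_subset_right
  rcases Nat.lt_or_ge (G.degree v) 2 with hlt | hge
  · have h0 : ∑ u ∈ (insert v (G.neighborFinset v))ᶜ,
        (G.neighborFinset u ∩ G.neighborFinset v).card.choose 2 = 0 :=
      Finset.sum_eq_zero fun u _ => Nat.choose_eq_zero_of_lt ((hle2 u).trans_lt hlt)
    exact ⟨by omega, fun h => by omega⟩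
  have hdeg : G.degree v = 2 := le_antisymm hv hge
  have hterm : ∀ u ∈ (insert v (G.neighborFinset v))ᶜ,
      (G.neighborFinset u ∩ G.neighborFinset v).card.choose 2 ≤ 1 := fun u _ =>
    Nat.choose_le_choose 2 ((hle2 u).trans hv)
  have hsum1 : ∑ u ∈ (insert v (G.neighborFinset v))ᶜ, 1 = Fintype.card V - 3 := by
    rw [Finset.sum_const, hcard, hdeg]
    simp
    omega
  refine ⟨hsum.trans ((Finset.sum_le_sum hterm).trans hsum1.le), fun heq => ?_⟩
  -- equality forces all vertices outside the neighbourhood to have the same two neighbours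
  have hall := (Finset.sum_eq_sum_iff_of_le hterm).1
    (le_antisymm (Finset.sum_le_sum hterm) (by rw [hsum1, ← heq]; exact hsum))
  obtain ⟨x, y, hxy, hN⟩ := Finset.card_eq_two.1 hdeg
  have hNv : ∀ w, G.Adj v w ↔ (w = x ∨ w = y) := by
    intro w
    rw [← SimpleGraph.mem_neighborFinset, hN]
    simp
  have hN2 : ∀ u, ¬ (u = x ∨ u = y) → G.Adj u x ∧ G.Adj u y := by
    intro u hu
    by_cases huv : u = v
    · subst huv
      exact ⟨(hNv x).2 (Or.inl rfl), (hNv y).2 (Or.inr rfl)⟩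
    have hmem : u ∈ (insert v (G.neighborFinset v))ᶜ := by
      rw [Finset.mem_compl, Finset.mem_insert, SimpleGraph.mem_neighborFinset, hNv, not_or]
      exact ⟨huv, hu⟩
    have h1 := hall u hmem
    have h2 : 2 ≤ (G.neighborFinset u ∩ G.neighborFinset v).card := by
      by_contra hlt
      rw [Nat.choose_eq_zero_of_lt (not_le.1 hlt)] at h1
      exact zero_ne_one h1
    have h3 : G.neighborFinset v ⊆ G.neighborFinset u :=
      Finset.inter_eq_right.1 (Finset.eq_of_subset_of_card_le Finset.inter_subset_right
        (by rw [SimpleGraph.card_neighborFinset_eq_degree, hdeg]; exact h2))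
    rw [← SimpleGraph.mem_neighborFinset, ← SimpleGraph.mem_neighborFinset]
    exact ⟨h3 (by rw [hN]; simp), h3 (by rw [hN]; simp)⟩
  have hvx := (hNv x).2 (Or.inl rfl)
  have hvy := (hNv y).2 (Or.inr rfl)
  have hxy' : ¬ G.Adj x y := fun h => hG _ _ _ hvx h hvy.symm
  refine ⟨x, y, hxy, fun a b => ?_⟩
  by_cases ha : a = x ∨ a = y <;> by_cases hb : b = x ∨ b = y
  · simp only [ha, hb, not_true, and_false, false_and, or_self, iff_false]
    rcases ha with rfl | rfl <;> rcases hb with rfl | rfl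
    exacts [G.irrefl, hxy', fun h => hxy' h.symm, G.irrefl]
  · simp only [ha, hb, not_false_eq_true, and_true, true_or, iff_true]
    rcases ha with rfl | rfl
    exacts [(hN2 b hb).1.symm, (hN2 b hb).2.symm]
  · simp only [ha, hb, not_false_eq_true, and_true, or_true, iff_true]
    rcases hb with rfl | rfl
    exacts [(hN2 a ha).1, (hN2 a ha).2]
  · simp only [ha, hb, not_false_eq_true, and_true, and_false, or_self, iff_false]
    exact fun h => hG _ _ _ (hN2 a ha).1.symm h (hN2 b hb).1

end

theorem exists_vertices_of_card_eq_three {α : Type*} {s : Finset α} (hs : s.card = 3) :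
    ∃ a : Fin 3 → α, Function.Injective a ∧ ∀ i, a i ∈ s :=
  ⟨fun i => (s.equivFinOfCardEq hs).symm i, Subtype.val_injective.comp (Equiv.injective _),
    fun i => ((s.equivFinOfCardEq hs).symm i).2⟩

theorem injective_vecCons_three {V : Type*} {a b c : V} (hab : a ≠ b) (hac : a ≠ c) (hbc : b ≠ c) :
    Function.Injective (![a, b, c] : Fin 3 → V) := by
  intro i j hij
  fin_cases i <;> fin_cases j <;>
    simp [hab, hac, hbc, hab.symm, hac.symm, hbc.symm] at hij ⊢

/-! ### Vertices of degree three -/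

/-- Three vertices that are adjacent to all neighbours of a vertex of degree three do not exist in a
triangle-free planar graph. -/
theorem false_of_neighborFinset_subset {V : Type*} [Fintype V] (G : SimpleGraph V)
    [DecidableRel G.Adj] (hP : IsPlanar G) {v x y : V} (hv : G.degree v = 3)
    (hvx : v ≠ x) (hvy : v ≠ y) (hxy : x ≠ y) (hx : G.neighborFinset v ⊆ G.neighborFinset x)
    (hy : G.neighborFinset v ⊆ G.neighborFinset y) : False := by
  obtain ⟨b, hb, hbv⟩ := exists_vertices_of_card_eq_three
    ((G.card_neighborFinset_eq_degree v).trans hv)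
  refine false_of_isPlanar_of_adj hP ![v, x, y] b (injective_vecCons_three hvx hvy hxy) hb
    fun i j => ?_
  fin_cases i
  · exact (G.mem_neighborFinset _ _).1 (hbv j)
  · exact (G.mem_neighborFinset _ _).1 (hx (hbv j))
  · exact (G.mem_neighborFinset _ _).1 (hy (hbv j))

section

variable {V : Type*} [Fintype V] [DecidableEq V] (G : SimpleGraph V) [DecidableRel G.Adj]

/-- Two adjacent vertices have disjoint neighbourhoods. -/
theorem six_le_card_of_three_le_degree (hG : ∀ a b c, G.Adj a b → G.Adj b c → ¬ G.Adj c a)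
    (hmin : ∀ u, 3 ≤ G.degree u) {v : V} : 6 ≤ Fintype.card V := by
  obtain ⟨a, ha⟩ : (G.neighborFinset v).Nonempty := by
    rw [← Finset.card_pos, SimpleGraph.card_neighborFinset_eq_degree]
    exact (hmin v).trans_lt' (by norm_num)
  rw [SimpleGraph.mem_neighborFinset] at ha
  have hdisj : Disjoint (G.neighborFinset v) (G.neighborFinset a) := by
    rw [Finset.disjoint_left]
    intro w hw hw'
    rw [SimpleGraph.mem_neighborFinset] at hw hw'
    exact hG _ _ _ ha hw' hw.symm
  have h1 := Finset.card_le_univ (G.neighborFinset v ∪ G.neighborFinset a)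
  rw [Finset.card_union_of_disjoint hdisj, SimpleGraph.card_neighborFinset_eq_degree,
    SimpleGraph.card_neighborFinset_eq_degree] at h1
  have := hmin v
  have := hmin a
  omega

/-- If the minimum degree is three, a vertex `v` of degree three is in at most `n - 3` four-cycles.
By the exclusion of `K₃,₃` at most one vertex `w` shares all three neighbours with `v`, and if there
is such a vertex, then some other vertex shares at most one neighbour with `v`. -/
theorem card_filter_fourCycles_le_of_degree_eq_three (hP : IsPlanar G)
    (hG : ∀ a b c, G.Adj a b → G.Adj b c → ¬ G.Adj c a) (hmin : ∀ u, 3 ≤ G.degree u) {v : V}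
    (hv : G.degree v = 3) : ((fourCycles G).filter (v ∈ ·)).card ≤ Fintype.card V - 3 := by
  have hsix := six_le_card_of_three_le_degree G hG hmin (v := v)
  refine (card_filter_fourCycles_le G hG v).trans ?_
  have hcard := card_compl_insert_neighborFinset G v
  set R := (insert v (G.neighborFinset v))ᶜ with hR
  have hmemR : ∀ u, u ∈ R ↔ u ≠ v ∧ ¬ G.Adj v u := by
    intro u
    rw [hR, Finset.mem_compl, Finset.mem_insert, SimpleGraph.mem_neighborFinset, not_or]
  set k : V → ℕ := fun u => (G.neighborFinset u ∩ G.neighborFinset v).card with hk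
  have hNv : (G.neighborFinset v).card = 3 := (G.card_neighborFinset_eq_degree v).trans hv
  have hk3 : ∀ u, k u ≤ 3 := fun u => (Finset.card_le_card Finset.inter_subset_right).trans hNv.le
  have hksub : ∀ u, k u = 3 → G.neighborFinset v ⊆ G.neighborFinset u := fun u hu =>
    Finset.inter_eq_right.1 (Finset.eq_of_subset_of_card_le Finset.inter_subset_right
      (hNv.trans hu.symm).le)
  change ∑ u ∈ R, (k u).choose 2 ≤ _
  have hchoose : ∀ u, k u ≠ 3 → (k u).choose 2 ≤ 1 := fun u hu =>
    Nat.choose_le_choose (b := 2) 2 (by have := hk3 u; omega)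
  by_cases hw : ∃ w ∈ R, k w = 3
  · obtain ⟨w, hwR, hw⟩ := hw
    have hw' := (hmemR w).1 hwR
    have hne3 : ∀ u ∈ R.erase w, k u ≠ 3 := by
      intro u hu hu3
      rw [Finset.mem_erase] at hu
      exact false_of_neighborFinset_subset G hP hv hw'.1.symm ((hmemR u).1 hu.2).1.symm hu.1.symm
        (hksub w hw) (hksub u hu3)
    -- a vertex of `R` other than `w` that shares at most one neighbour with `v`
    obtain ⟨u₀, hu₀, hku₀⟩ : ∃ u ∈ R.erase w, k u < 2 := by
      by_contra! hall
      have hall' : ∀ u ∈ R, 2 ≤ k u := by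
        intro u hu
        by_cases huw : u = w
        · rw [huw, hw]
          norm_num
        · exact hall u (Finset.mem_erase.2 ⟨huw, hu⟩)
      obtain ⟨a, ha⟩ : (G.neighborFinset v).Nonempty := by
        rw [← Finset.card_pos, hNv]
        norm_num
      have hva := (G.mem_neighborFinset _ _).1 ha
      obtain ⟨r, hra, hr⟩ : ∃ r ∈ G.neighborFinset a, r ∉ ({v, w} : Finset V) := by
        refine Finset.exists_mem_notMem_of_card_lt_card ?_
        rw [SimpleGraph.card_neighborFinset_eq_degree]
        exact Finset.card_le_two.trans_lt (hmin a)
      rw [SimpleGraph.mem_neighborFinset] at hra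
      rw [Finset.mem_insert, Finset.mem_singleton, not_or] at hr
      have hrR : r ∈ R := (hmemR r).2 ⟨hr.1, fun h => hG _ _ _ hva hra h.symm⟩
      have hr3 := hne3 r (Finset.mem_erase.2 ⟨hr.2, hrR⟩)
      obtain ⟨r', hr', hr'v⟩ : ∃ r' ∈ G.neighborFinset r,
          r' ∉ G.neighborFinset r ∩ G.neighborFinset v := by
        refine Finset.exists_mem_notMem_of_card_lt_card ?_
        rw [SimpleGraph.card_neighborFinset_eq_degree]
        exact (lt_of_le_of_ne (hk3 r) hr3).trans_le (hmin r)
      have hrr' := (G.mem_neighborFinset _ _).1 hr'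
      have hr'R : r' ∈ R := by
        refine (hmemR r').2 ⟨?_, fun h => hr'v (Finset.mem_inter.2
          ⟨hr', (G.mem_neighborFinset _ _).2 h⟩)⟩
        rintro rfl
        exact ((hmemR r).1 hrR).2 hrr'.symm
      -- two pairs of neighbours of `v` intersect, which gives a triangle on the edge `r r'`
      have h1 := Finset.card_union_add_card_inter (G.neighborFinset r ∩ G.neighborFinset v)
        (G.neighborFinset r' ∩ G.neighborFinset v)
      have h2 : ((G.neighborFinset r ∩ G.neighborFinset v) ∪
          (G.neighborFinset r' ∩ G.neighborFinset v)).card ≤ 3 :=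
        (Finset.card_le_card (Finset.union_subset Finset.inter_subset_right
          Finset.inter_subset_right)).trans hNv.le
      have h3 := hall' r hrR
      have h4 := hall' r' hr'R
      obtain ⟨p, hp⟩ : ((G.neighborFinset r ∩ G.neighborFinset v) ∩
          (G.neighborFinset r' ∩ G.neighborFinset v)).Nonempty := by
        rw [← Finset.card_pos]
        simp only [hk] at h3 h4
        omega
      simp only [Finset.mem_inter, SimpleGraph.mem_neighborFinset] at hp
      exact hG _ _ _ hrr' hp.2.1 hp.1.1.symm
    rw [← Finset.add_sum_erase R _ hwR, hw]
    have hlt : ∑ u ∈ R.erase w, (k u).choose 2 < ∑ u ∈ R.erase w, 1 :=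
      Finset.sum_lt_sum (fun u hu => hchoose u (hne3 u hu))
        ⟨u₀, hu₀, by rw [Nat.choose_eq_zero_of_lt hku₀]; exact one_pos⟩
    rw [Finset.sum_const, Finset.card_erase_of_mem hwR, smul_eq_mul, mul_one] at hlt
    have h32 : Nat.choose 3 2 = 3 := rfl
    omega
  · push Not at hw
    refine (Finset.sum_le_card_nsmul R _ 1 fun u hu => hchoose u (hw u hu)).trans ?_
    rw [smul_eq_mul, mul_one]
    omega

/-- Adding a vertex to `K_{2,n-3}` so that the minimum degree becomes three creates `K₃,₃`. -/
theorem false_of_isCompleteBipartiteTwo_comap (hP : IsPlanar G)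
    (hG : ∀ a b c, G.Adj a b → G.Adj b c → ¬ G.Adj c a) (hmin : ∀ u, 3 ≤ G.degree u) {v : V}
    (hv : G.degree v = 3) {x y : {w // w ≠ v}}
    (h : IsCompleteBipartiteTwo (G.comap (Subtype.val : {w // w ≠ v} → V)) x y) : False := by
  have hadj : ∀ t : V, ∀ ht : t ≠ v, t ≠ x → t ≠ y → ∀ s : V, ∀ hs : s ≠ v,
      G.Adj t s ↔ s = x ∨ s = y := by
    intro t ht htx hty s hs
    have := h.2 ⟨t, ht⟩ ⟨s, hs⟩
    rw [SimpleGraph.comap_adj] at this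
    rw [this]
    simp [Subtype.ext_iff, htx, hty]
  -- every vertex other than `v`, `x` and `y` has `v` as its third neighbour
  have hvt : ∀ t : V, t ≠ v → t ≠ x → t ≠ y → G.Adj t v := by
    intro t ht htx hty
    obtain ⟨s, hs, hs'⟩ : ∃ s ∈ G.neighborFinset t, s ∉ ({x.1, y.1} : Finset V) := by
      refine Finset.exists_mem_notMem_of_card_lt_card ?_
      rw [SimpleGraph.card_neighborFinset_eq_degree]
      exact Finset.card_le_two.trans_lt (hmin t)
    rw [SimpleGraph.mem_neighborFinset] at hs
    by_cases hsv : s = v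
    · rwa [← hsv]
    · have := (hadj t ht htx hty s hsv).1 hs
      simp [this] at hs'
  obtain ⟨t, ht⟩ : ∃ t, t ∉ ({v, x.1, y.1} : Finset V) := by
    by_contra! hall
    have h1 := six_le_card_of_three_le_degree G hG hmin (v := v)
    have h2 : ({v, x.1, y.1} : Finset V).card ≤ 3 := Finset.card_le_three
    rw [Finset.eq_univ_iff_forall.2 hall, Finset.card_univ] at h2
    omega
  simp only [Finset.mem_insert, Finset.mem_singleton, not_or] at ht
  have htv := hvt t ht.1 ht.2.1 ht.2.2
  have htx := (hadj t ht.1 ht.2.1 ht.2.2 x x.2).2 (Or.inl rfl)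
  have hty := (hadj t ht.1 ht.2.1 ht.2.2 y y.2).2 (Or.inr rfl)
  have hnb : ∀ s ∈ G.neighborFinset v, s ≠ v ∧ s ≠ x ∧ s ≠ y := by
    intro s hs
    rw [SimpleGraph.mem_neighborFinset] at hs
    refine ⟨hs.ne.symm, ?_, ?_⟩
    · rintro rfl
      exact hG _ _ _ htv hs htx.symm
    · rintro rfl
      exact hG _ _ _ htv hs hty.symm
  refine false_of_neighborFinset_subset G hP hv x.2.symm y.2.symm
    (fun hxy => h.1 (Subtype.ext hxy)) (fun s hs => ?_) (fun s hs => ?_)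
  · obtain ⟨h1, h2, h3⟩ := hnb s hs
    exact (G.mem_neighborFinset _ _).2 ((hadj s h1 h2 h3 x x.2).2 (Or.inl rfl)).symm
  · obtain ⟨h1, h2, h3⟩ := hnb s hs
    exact (G.mem_neighborFinset _ _).2 ((hadj s h1 h2 h3 y y.2).2 (Or.inr rfl)).symm

end

/-! ### The extremal graphs -/

/-- The upper bound and the uniqueness of the extremal graph, for `n + 3` vertices. The induction
step deletes a vertex that is in at most `n` four-cycles. -/
theorem card_fourCycles_le_choose (n : ℕ) : ∀ {V : Type*} [Fintype V] [DecidableEq V]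
    (G : SimpleGraph V), Fintype.card V = n + 3 → IsPlanar G →
    (∀ a b c, G.Adj a b → G.Adj b c → ¬ G.Adj c a) →
    (fourCycles G).card ≤ (n + 1).choose 2 ∧ (1 ≤ n → (fourCycles G).card = (n + 1).choose 2 →
      ∃ x y, IsCompleteBipartiteTwo G x y) := by
  induction n with
  | zero =>
    intro V _ _ G hV hP hG
    have h0 : fourCycles G = ∅ := by
      refine Finset.eq_empty_of_forall_notMem fun Q hQ => ?_
      obtain ⟨a, b, c, d, hab, hbc, hcd, hda, hac, hbd, -⟩ := mem_fourCycles.1 hQ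
      have := Fintype.card_le_of_injective _
        (injective_vecCons_four hab.ne hac hda.ne.symm hbc.ne hbd hcd.ne)
      simp [hV] at this
    simp [h0]
  | succ n ih =>
    intro V _ _ G hV hP hG
    classical
    have : Nonempty V := Fintype.card_pos_iff.1 (by omega)
    have hdel : ∀ v : V, (fourCycles (G.comap (Subtype.val : {w // w ≠ v} → V))).card ≤
        (n + 1).choose 2 ∧ (1 ≤ n →
        (fourCycles (G.comap (Subtype.val : {w // w ≠ v} → V))).card = (n + 1).choose 2 →
        ∃ x y, IsCompleteBipartiteTwo (G.comap (Subtype.val : {w // w ≠ v} → V)) x y) := by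
      intro v
      refine ih _ ?_ (hP.of_copy Subtype.val Subtype.val_injective fun _ _ h => h)
        fun a b c h1 h2 h3 => hG _ _ _ h1 h2 h3
      have := Fintype.card_subtype_compl fun w : V => w = v
      rw [Fintype.card_subtype_eq, hV] at this
      convert this using 1
      omega
    have hchoose : (n + 1 + 1).choose 2 = (n + 1) + (n + 1).choose 2 := by
      rw [Nat.choose_succ_succ' (n + 1) 1, Nat.choose_one_right]
    by_cases hmin : ∃ v, G.degree v ≤ 2
    · obtain ⟨v, hv⟩ := hmin
      obtain ⟨h1, h2⟩ := card_filter_fourCycles_le_of_degree_le_two G hG (by omega) hv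
      have h3 := card_fourCycles_le G v
      have h4 := (hdel v).1
      exact ⟨by omega, fun _ h => h2 (by omega)⟩
    · push Not at hmin
      obtain ⟨v, hv⟩ := exists_degree_le_three hP hG
      have hv3 : G.degree v = 3 := le_antisymm hv (hmin v)
      have h1 := card_filter_fourCycles_le_of_degree_eq_three G hP hG hmin hv3
      have h3 := card_fourCycles_le G v
      have h4 := (hdel v).1
      refine ⟨by omega, fun _ h => ?_⟩
      have h6 := six_le_card_of_three_le_degree G hG hmin (v := v)
      obtain ⟨x, y, hxy⟩ := (hdel v).2 (by omega) (by omega)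
      exact (false_of_isCompleteBipartiteTwo_comap G hP hG hmin hv3 hxy).elim

theorem IsCompleteBipartiteTwo.choose_le {V : Type*} [Fintype V] [DecidableEq V]
    {G : SimpleGraph V} {x y : V} (h : IsCompleteBipartiteTwo G x y) :
    (Fintype.card V - 2).choose 2 ≤ (fourCycles G).card := by
  have h1 : ({x, y}ᶜ : Finset V).card = Fintype.card V - 2 := by
    rw [Finset.card_compl, Finset.card_pair h.1]
  rw [← h1, ← Finset.card_powersetCard]
  refine Finset.card_le_card_of_injOn (fun P => {x, y} ∪ P) ?_ ?_
  · intro P hP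
    rw [Finset.mem_coe, Finset.mem_powersetCard] at hP
    obtain ⟨p, q, hpq, rfl⟩ := Finset.card_eq_two.1 hP.2
    have hp : ¬ (p = x ∨ p = y) := by
      simpa using Finset.mem_compl.1 (hP.1 (Finset.mem_insert_self p _))
    have hq : ¬ (q = x ∨ q = y) := by
      simpa using Finset.mem_compl.1 (hP.1 (Finset.mem_insert_of_mem (Finset.mem_singleton_self q)))
    refine mem_fourCycles.2 ⟨x, p, y, q, (h.2 _ _).2 (by simp [hp]), (h.2 _ _).2 (by simp [hp]),
      (h.2 _ _).2 (by simp [hq]), (h.2 _ _).2 (by simp [hq]), h.1, hpq, ?_⟩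
    ext
    simp
    tauto
  · intro P hP Q hQ hPQ
    rw [Finset.mem_coe, Finset.mem_powersetCard] at hP hQ
    have hPd : Disjoint {x, y} P := Finset.disjoint_right.2 fun z hz => Finset.mem_compl.1 (hP.1 hz)
    have hQd : Disjoint {x, y} Q := Finset.disjoint_right.2 fun z hz => Finset.mem_compl.1 (hQ.1 hz)
    rw [← Finset.union_sdiff_cancel_left hPd, ← Finset.union_sdiff_cancel_left hQd]
    exact congrArg (· \ {x, y}) hPQ

theorem IsCompleteBipartiteTwo.not_adj {V : Type*} {G : SimpleGraph V} {x y : V}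
    (h : IsCompleteBipartiteTwo G x y) (a b c : V) : G.Adj a b → G.Adj b c → ¬ G.Adj c a := by
  rw [h.2, h.2, h.2]
  tauto

theorem isPlanar_and_free_and_copyCount_iff {V : Type*} [Fintype V] (G : SimpleGraph V) {n : ℕ}
    (hn : 4 ≤ n) (hV : Fintype.card V = n) :
    (IsPlanar G ∧ (SimpleGraph.cycleGraph 3).Free G ∧
      G.copyCount (SimpleGraph.cycleGraph 4) = (n - 2).choose 2) ↔
    Nonempty (G ≃g completeBipartiteGraph (Fin 2) (Fin (n - 2))) := by
  classical
  have hn3 : n - 2 = n - 3 + 1 := by omega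
  have hV3 : Fintype.card V = n - 3 + 3 := by omega
  constructor
  · rintro ⟨hP, hfree, hcount⟩
    have hG := free_cycleGraph_three_iff.1 hfree
    rw [copyCount_cycleGraph_four hG, hn3] at hcount
    exact (nonempty_iso_completeBipartiteGraph_iff G hV).2
      ((card_fourCycles_le_choose _ G hV3 hP hG).2 (by omega) hcount)
  · rintro ⟨φ⟩
    obtain ⟨x, y, h⟩ := (nonempty_iso_completeBipartiteGraph_iff G hV).1 ⟨φ⟩
    have hG := h.not_adj
    have hP : IsPlanar G := (isPlanar_completeBipartiteGraph_two (n - 2)).of_copy φ φ.injective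
      fun _ _ hab => φ.map_adj_iff.2 hab
    refine ⟨hP, free_cycleGraph_three_iff.2 hG, ?_⟩
    rw [copyCount_cycleGraph_four hG]
    refine le_antisymm ?_ (hV ▸ h.choose_le)
    rw [hn3]
    exact (card_fourCycles_le_choose _ G hV3 hP hG).1

end PlanarTuran

theorem mainTheorem3 (n : ℕ) (hn : 4 ≤ n) :
    IsGreatest
      (PlanarTuran.planarCopyCounts n (SimpleGraph.cycleGraph 4) (SimpleGraph.cycleGraph 3))
      ((n - 2).choose 2) ∧
    ∀ (V : Type*) [Fintype V] (G : SimpleGraph V), Fintype.card V = n →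
      ((PlanarTuran.IsPlanar G ∧ (SimpleGraph.cycleGraph 3).Free G ∧
          G.copyCount (SimpleGraph.cycleGraph 4) = (n - 2).choose 2) ↔
        Nonempty (G ≃g completeBipartiteGraph (Fin 2) (Fin (n - 2)))) := by
  refine ⟨⟨?_, ?_⟩, fun V _ G hV => PlanarTuran.isPlanar_and_free_and_copyCount_iff G hn hV⟩
  · have e : Fin n ≃ Fin 2 ⊕ Fin (n - 2) := Fintype.equivOfCardEq (by simp; omega)
    exact ⟨(completeBipartiteGraph (Fin 2) (Fin (n - 2))).comap e,
      (PlanarTuran.isPlanar_and_free_and_copyCount_iff _ hn (Fintype.card_fin n)).2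
        ⟨SimpleGraph.Iso.comap e _⟩⟩
  · rintro m ⟨G, hP, hfree, rfl⟩
    have hG := PlanarTuran.free_cycleGraph_three_iff.1 hfree
    have h := (PlanarTuran.card_fourCycles_le_choose (n - 3) G
      (by rw [Fintype.card_fin]; omega) hP hG).1
    rw [PlanarTuran.copyCount_cycleGraph_four hG]
    rwa [show n - 3 + 1 = n - 2 by omega] at h
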